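/- Let $n\ge 0$, let $Z=(z_0,\dots,z_n)$ be the homogeneous coordinates of $\mathbb{CP}^n$, and for an open $U\subseteq\mathbb{CP}^n$ let $\mathcal O(k)(U)$ be the space of holomorphic functions, homogeneous of degree $k$, on the cone over $U$ in $\mathbb C^{n+1}\setminus\{0\}$; write $\mathcal O=\mathcal O(0)$. Let $\Lambda^{\alpha\beta}=-\Lambda^{\beta\alpha}$ $(0\le\alpha,\beta\le n)$ be holomorphic functions on $\mathbb C^{n+1}\setminus\{0\}$, homogeneous of degree $2$, such that the biderivation $\{f,g\}=\sum_{\alpha,\beta}\Lambda^{\alpha\beta}\,\partial_{Z_\alpha}f\,\partial_{Z_\beta}g$ satisfies the Jacobi identity on the structure sheaf $\mathcal O$ of $\mathbb{CP}^n$. For $k\ge0$ and holomorphic $f,g$ put $$B_k(f,g)=\sum_{\alpha_1,\dots,\alpha_k,\beta_1,\dots,\beta_k}\Lambda^{\alpha_1\beta_1}\cdots\Lambda^{\alpha_k\beta_k}\;\partial_{Z_{\alpha_1}}\cdots\partial_{Z_{\alpha_k}}f\;\partial_{Z_{\beta_1}}\cdots\partial_{Z_{\beta_k}}g ,$$ and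 assume that for every $k\ge 0$ and all functions $f,g$ holomorphic on an open subset of $\mathbb C^{n+1}\setminus\{0\}$ $$\sum f\,\bigl(\overleftarrow{\partial_{Z_{\alpha_1}}}\Lambda^{\alpha_1\beta_1}\overrightarrow{\partial_{Z_{\beta_1}}}\bigr)\cdots\bigl(\overleftarrow{\partial_{Z_{\alpha_k}}}\Lambda^{\alpha_k\beta_k}\overrightarrow{\partial_{Z_{\beta_k}}}\bigr)\,g=B_k(f,g),$$ where on the left each $\overleftarrow{\partial}$ differentiates everything to its left and each $\overrightarrow{\partial}$ everything to its right (including the coefficients $\Lambda$). Let $\mu$ be a formal parameter and let $[[\natural]]$ denote formal power series in $\mu$, Laurent polynomials in $\mu$, formal Laurent series in $\mu$, or formal Laurent series in $\mu^{-1}$. Then $$f\star g=\sum_{p\ge 0}\frac1{p!}\Bigl(\frac{\mu}{2}\Bigr)^pB_p(f,g),$$ extended linearly over the powers of $\mu$, is globally defined: for $f\in H^0(\mathbb{CP}^n,\mathcal O(k))[[\natural]]$ and $g\in H^0(\mathbb{CP}^n,\mathcal O(l))[[\natural]]$, $k,l\ge 0$, only finitely many terms contribute to each power of $\mu$, and $f\star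 g\in H^0(\mathbb{CP}^n,\mathcal O(k+l))[[\natural]]$. It makes $\bigoplus_{k\ge0}H^0(\mathbb{CP}^n,\mathcal O(k))[[\natural]]$ an associative algebra with unit $1$, which is noncommutative if $\Lambda\neq0$. Moreover $\mu$ can be specialized to any scalar $c\in\mathbb C$ (for example $c=1$): for $f,g$ without $\mu$ the sum defining $f\star g$ is finite, and with $\mu=c$ it defines an associative product with unit $1$ on $\bigoplus_{k\ge0}H^0(\mathbb{CP}^n,\mathcal O(k))$, which is noncommutative if $\Lambda\ne0$ and $c\neq0$; for $c\ne0$ the substitution $\mu=c$ is multiplicative from $\bigoplus_{k\ge 0} H^0(\mathbb{CP}^n,\mathcal O(k))[\mu,\mu^{-1}]$ to this algebra. -/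

import Mathlib

open scoped LinearAlgebra.Projectivization DirectSum

noncomputable section

namespace StarCP

/-- The space of homogeneous coordinates `Z = (z_0, …, z_n)`. -/
abbrev Coord (n : ℕ) : Type := Fin (n + 1) → ℂ

/-- Complex projective space. -/
abbrev CP (n : ℕ) : Type := ℙ ℂ (Coord n)

/-- The cone over `U ⊆ CP n`: all nonzero `z` whose class `[z_0 : … : z_n]` lies in `U`.
`U` is open (in the quotient topology) iff its cone is open. -/
def cone {n : ℕ} (U : Set (CP n)) : Set (Coord n) :=
  {z | ∃ hz : z ≠ 0, Projectivization.mk ℂ z hz ∈ U}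

/-- The sections of the sheaf `O(k)` over `U ⊆ CP n`: the holomorphic functions on the cone over
`U` that are homogeneous of degree `k`. Such a function is recorded through its extension by zero
to the whole coordinate space, so that two sections are equal iff they agree on the cone. -/
def sections (n : ℕ) (k : ℤ) (U : Set (CP n)) : Submodule ℂ (Coord n → ℂ) where
  carrier := {f | DifferentiableOn ℂ f (cone U) ∧
    (∀ z ∈ cone U, ∀ t : ℂ, t ≠ 0 → f (t • z) = t ^ k * f z) ∧ ∀ z, z ∉ cone U → f z = 0}
  add_mem' := by
    rintro f g ⟨hf, hf', hf''⟩ ⟨hg, hg', hg''⟩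
    refine ⟨hf.add hg, fun z hz t ht => ?_, fun z hz => ?_⟩
    · simp only [Pi.add_apply, hf' z hz t ht, hg' z hz t ht, mul_add]
    · simp only [Pi.add_apply, hf'' z hz, hg'' z hz, add_zero]
  zero_mem' := ⟨differentiableOn_const 0, fun _ _ _ _ => by simp, fun _ _ => rfl⟩
  smul_mem' := by
    rintro c f ⟨hf, hf', hf''⟩
    refine ⟨hf.const_smul c, fun z hz t ht => ?_, fun z hz => ?_⟩
    · simp only [Pi.smul_apply, hf' z hz t ht, smul_eq_mul]; ring
    · simp only [Pi.smul_apply, hf'' z hz, smul_zero]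

/-- `H⁰(CP n, O(k))`, the global sections of `O(k)`. -/
abbrev H0 (n : ℕ) (k : ℤ) : Submodule ℂ (Coord n → ℂ) := sections n k Set.univ

theorem mem_cone_univ {n : ℕ} {z : Coord n} : z ∈ cone (Set.univ : Set (CP n)) ↔ z ≠ 0 := by
  simp [cone]

/-- The constant section `1` of `O(0)`. -/
def oneSection (n : ℕ) : H0 n ((0 : ℕ) : ℤ) :=
  ⟨fun z => if z = 0 then 0 else 1, by
    refine ⟨?_, fun z hz t ht => ?_, fun z hz => ?_⟩
    · refine (differentiableOn_const (1 : ℂ)).congr fun z hz => ?_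
      simp [mem_cone_univ.1 hz]
    · simp [mem_cone_univ.1 hz, ht]
    · have : z = 0 := by simpa [mem_cone_univ] using hz
      simp [this]⟩

/-- The holomorphic partial derivative `∂_{Z_α}`. -/
def partialZ {n : ℕ} (α : Fin (n + 1)) (f : Coord n → ℂ) : Coord n → ℂ :=
  fun z => fderiv ℂ f z (Pi.single α 1)

/-- The iterated derivative `∂_{Z_{α_1}} ⋯ ∂_{Z_{α_k}}` for a list `α_1, …, α_k`. -/
def partials {n : ℕ} (l : List (Fin (n + 1))) (f : Coord n → ℂ) : Coord n → ℂ :=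
  l.foldr partialZ f

/-- Coefficients `Λ^{α,β}`, as functions of the homogeneous coordinates. -/
abbrev Coeffs (n : ℕ) : Type := Fin (n + 1) → Fin (n + 1) → Coord n → ℂ

/-- The biderivation `{f, g} = ∑ Λ^{α,β} ∂_{Z_α} f ∂_{Z_β} g`. -/
def bracket {n : ℕ} (Λ : Coeffs n) (f g : Coord n → ℂ) : Coord n → ℂ :=
  fun z => ∑ α, ∑ β, Λ α β z * partialZ α f z * partialZ β g z

/-- `Λ` is a holomorphic skew-symmetric biderivation of order zero (the coefficients are
holomorphic of degree two, so that the bracket of two functions of degree zero has degree zero)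
which satisfies the Jacobi rule on the structure sheaf `O = O(0)` of `CP n`. -/
structure IsHolomorphicPoisson {n : ℕ} (Λ : Coeffs n) : Prop where
  holomorphic : ∀ α β, Λ α β ∈ H0 n 2
  skew : ∀ α β z, Λ α β z = -Λ β α z
  jacobi : ∀ U : Set (CP n), IsOpen (cone U) →
    ∀ f ∈ sections n 0 U, ∀ g ∈ sections n 0 U, ∀ h ∈ sections n 0 U, ∀ z ∈ cone U,
      bracket Λ f (bracket Λ g h) z + bracket Λ g (bracket Λ h f) z
        + bracket Λ h (bracket Λ f g) z = 0

/-- The `k`-th bidifferential operator without derivatives of the coefficients,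
`∑ Λ^{α_1,β_1} ⋯ Λ^{α_k,β_k} (∂_{Z_{α_1}} ⋯ ∂_{Z_{α_k}} f) (∂_{Z_{β_1}} ⋯ ∂_{Z_{β_k}} g)`. -/
def symbolPower {n : ℕ} (Λ : Coeffs n) (k : ℕ) (f g : Coord n → ℂ) : Coord n → ℂ :=
  fun z => ∑ α : Fin k → Fin (n + 1), ∑ β : Fin k → Fin (n + 1),
    (∏ i, Λ (α i) (β i) z) * partials (List.ofFn α) f z * partials (List.ofFn β) g z

/-- The ordered product
`f (∂←_{α_1} Λ^{α_1,β_1} ∂→_{β_1}) ⋯ (∂←_{α_k} Λ^{α_k,β_k} ∂→_{β_k}) g`, summed over the indices,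
in which `∂←` differentiates everything to its left and `∂→` everything to its right.
There are `k + 2` factors `f, Λ^{α_1,β_1}, …, Λ^{α_k,β_k}, g`, in the slots `0, …, k + 1`, and by
the Leibniz rule the product is the sum over all ways to let the `i`-th `∂←` hit a slot `a i` to
the left of the `i`-th coefficient and the `i`-th `∂→` a slot `b i` to the right of it. -/
def orderedPower {n : ℕ} (Λ : Coeffs n) (k : ℕ) (f g : Coord n → ℂ) : Coord n → ℂ :=
  fun z => ∑ α : Fin k → Fin (n + 1), ∑ β : Fin k → Fin (n + 1),
    ∑ a : Fin k → Fin (k + 2) with ∀ i, a i < i.succ.castSucc,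
    ∑ b : Fin k → Fin (k + 2) with ∀ i, i.succ.castSucc < b i,
      ∏ j : Fin (k + 2),
        partials
          (((List.finRange k).filter fun i => a i = j).map α
            ++ ((List.finRange k).filter fun i => b i = j).map β)
          ((Fin.cons f (Fin.snoc (fun i => Λ (α i) (β i)) g : Fin (k + 1) → Coord n → ℂ) :
            Fin (k + 2) → Coord n → ℂ) j) z

/-- The ordered powers of `∂←_α Λ^{α,β} ∂→_β` agree with the powers in which the coefficients are
not differentiated, as bidifferential operators on holomorphic functions of `Z ≠ 0`. -/
def OrderedRelation {n : ℕ} (Λ : Coeffs n) : Prop :=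
  ∀ (k : ℕ) (W : Set (Coord n)), IsOpen W → (0 : Coord n) ∉ W →
    ∀ f g : Coord n → ℂ, DifferentiableOn ℂ f W → DifferentiableOn ℂ g W →
      ∀ z ∈ W, orderedPower Λ k f g z = symbolPower Λ k f g z

/-- The kinds of formal objects in the parameter `μ`: formal power series `[[μ]]`, Laurent
polynomials `[μ, μ⁻¹]`, Laurent series with finitely many negative powers, and Laurent series
`[μ, μ⁻¹]]` with finitely many positive powers. -/
inductive FormalKind
  | powerSeries
  | laurentPolynomial
  | laurentSeries
  | inverseLaurentSeries

/-- The sets of exponents of `μ` that are allowed. -/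
def FormalKind.Admissible : FormalKind → Set ℤ → Prop
  | .powerSeries, s => s ⊆ Set.Ici 0
  | .laurentPolynomial, s => s.Finite
  | .laurentSeries, s => BddBelow s
  | .inverseLaurentSeries, s => BddAbove s

theorem FormalKind.Admissible.mono {κ : FormalKind} {s t : Set ℤ} (ht : κ.Admissible t)
    (h : s ⊆ t) : κ.Admissible s := by
  cases κ
  · exact h.trans ht
  · exact Set.Finite.subset ht h
  · exact BddBelow.mono h ht
  · exact BddAbove.mono h ht

theorem FormalKind.Admissible.union {κ : FormalKind} {s t : Set ℤ} (hs : κ.Admissible s)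
    (ht : κ.Admissible t) : κ.Admissible (s ∪ t) := by
  cases κ
  · exact Set.union_subset hs ht
  · exact Set.Finite.union hs ht
  · exact BddBelow.union hs ht
  · exact BddAbove.union hs ht

theorem FormalKind.admissible_empty (κ : FormalKind) : κ.Admissible ∅ := by
  cases κ
  · exact Set.empty_subset _
  · exact Set.finite_empty
  · exact bddBelow_empty
  · exact bddAbove_empty

theorem FormalKind.admissible_singleton_zero (κ : FormalKind) : κ.Admissible {0} := by
  cases κ
  · intro x hx
    exact (Set.mem_singleton_iff.1 hx).ge
  · exact Set.finite_singleton _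
  · exact bddBelow_singleton
  · exact bddAbove_singleton

/-- Formal series `∑ μ^m x_m` of the given kind with all `x_m` in `H⁰(CP n, O(k))`, as the
families of their coefficients. -/
def formalSections (κ : FormalKind) (n k : ℕ) : Submodule ℂ (ℤ → H0 n k) where
  carrier := {x | κ.Admissible (Function.support x)}
  add_mem' hx hy := (hx.union hy).mono (Function.support_add _ _)
  zero_mem' := by
    have h := κ.admissible_empty
    rwa [← Function.support_zero (ι := ℤ) (M := H0 n k)] at h
  smul_mem' c _ hx := FormalKind.Admissible.mono hx (Function.support_const_smul_subset c _)

/-- `⊕_{k ≥ 0} H⁰(CP n, O(k))`. -/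
abbrev SectionSpace (n : ℕ) : Type := ⨁ k : ℕ, H0 n k

/-- `⊕_{k ≥ 0} (H⁰(CP n, O(k)) with formal parameter μ of the given kind)`. -/
abbrev FormalSectionSpace (κ : FormalKind) (n : ℕ) : Type := ⨁ k : ℕ, formalSections κ n k

/-- The constant `1` in `⊕ H⁰(CP n, O(k))`. -/
def one (n : ℕ) : SectionSpace n :=
  DirectSum.lof ℂ ℕ (fun k : ℕ => H0 n k) 0 (oneSection n)

/-- The constant `1 = 1 μ⁰` in the formal space. -/
def formalOne (κ : FormalKind) (n : ℕ) : FormalSectionSpace κ n :=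
  DirectSum.lof ℂ ℕ (fun k : ℕ => formalSections κ n k) 0
    ⟨Pi.single 0 (oneSection n), κ.admissible_singleton_zero.mono Pi.support_single_subset⟩

/-- `P` is the product `f ⋆ g = ∑_p (1/p!) (μ/2)^p Λ ⋯ Λ ∂ ⋯ ∂ f ∂ ⋯ ∂ g` on formal sections, where
`μ` is central: for `f = ∑ μ^i f_i` of degree `k` and `g = ∑ μ^j g_j` of degree `l`, only finitely
many terms of `f ⋆ g` contribute to each power `μ^m`, and `f ⋆ g` is a formal section of `O(k + l)`
whose coefficient of `μ^m` is the sum of the terms with `p + i + j = m`. -/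
def IsStarProduct {n : ℕ} (Λ : Coeffs n) (κ : FormalKind)
    (P : FormalSectionSpace κ n →ₗ[ℂ] FormalSectionSpace κ n →ₗ[ℂ] FormalSectionSpace κ n) :
    Prop :=
  ∀ (k l : ℕ) (f : formalSections κ n k) (g : formalSections κ n l),
    (∀ m : ℤ, {t : ℕ × ℤ |
      symbolPower Λ t.1 (f.1 t.2).1 (g.1 (m - t.1 - t.2)).1 ≠ 0}.Finite) ∧
    ∃ e : formalSections κ n (k + l),
      P (DirectSum.lof ℂ ℕ (fun k : ℕ => formalSections κ n k) k f)
          (DirectSum.lof ℂ ℕ (fun k : ℕ => formalSections κ n k) l g)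
        = DirectSum.lof ℂ ℕ (fun k : ℕ => formalSections κ n k) (k + l) e ∧
      ∀ (m : ℤ) (z : Coord n), z ≠ 0 →
        (e.1 m).1 z = ∑ᶠ t : ℕ × ℤ, (1 / (t.1.factorial : ℂ)) * (1 / 2) ^ t.1 *
          symbolPower Λ t.1 (f.1 t.2).1 (g.1 (m - t.1 - t.2)).1 z

/-- `P` is the product `f ⋆ g = ∑_p (1/p!) (c/2)^p Λ ⋯ Λ ∂ ⋯ ∂ f ∂ ⋯ ∂ g` on `⊕ H⁰(CP n, O(k))`,
in which the parameter is the scalar `c`; for given `f` and `g` the sum is finite. -/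
def IsScalarStarProduct {n : ℕ} (Λ : Coeffs n) (c : ℂ)
    (P : SectionSpace n →ₗ[ℂ] SectionSpace n →ₗ[ℂ] SectionSpace n) : Prop :=
  ∀ (k l : ℕ) (f : H0 n k) (g : H0 n l),
    {p : ℕ | symbolPower Λ p f.1 g.1 ≠ 0}.Finite ∧
    ∃ e : H0 n ((k + l : ℕ) : ℤ),
      P (DirectSum.lof ℂ ℕ (fun k : ℕ => H0 n k) k f)
          (DirectSum.lof ℂ ℕ (fun k : ℕ => H0 n k) l g)
        = DirectSum.lof ℂ ℕ (fun k : ℕ => H0 n k) (k + l) e ∧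
      ∀ z : Coord n, z ≠ 0 →
        e.1 z = ∑ᶠ p : ℕ, (1 / (p.factorial : ℂ)) * (c / 2) ^ p * symbolPower Λ p f.1 g.1 z

/-- The substitution `μ = c` in Laurent polynomials with coefficients in `H⁰(CP n, O(k))`. -/
def specializeDegree (n k : ℕ) (c : ℂ) :
    formalSections .laurentPolynomial n k →ₗ[ℂ] H0 n k where
  toFun x := ∑ᶠ m : ℤ, c ^ m • x.1 m
  map_add' x y := by
    have hx : (Function.support fun m : ℤ => c ^ m • x.1 m).Finite :=
      Set.Finite.subset x.2 fun m hm h => hm (by simp [h])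
    have hy : (Function.support fun m : ℤ => c ^ m • y.1 m).Finite :=
      Set.Finite.subset y.2 fun m hm h => hm (by simp [h])
    rw [← finsum_add_distrib hx hy]
    simp [smul_add]
  map_smul' a x := by
    have hx : (Function.support fun m : ℤ => c ^ m • x.1 m).Finite :=
      Set.Finite.subset x.2 fun m hm h => hm (by simp [h])
    rw [RingHom.id_apply, smul_finsum' a hx]
    refine finsum_congr fun m => ?_
    simp [smul_comm a]

/-- The substitution `μ = c` on `⊕_{k ≥ 0} H⁰(CP n, O(k))[μ, μ⁻¹]`. -/
def specialize (n : ℕ) (c : ℂ) :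
    FormalSectionSpace .laurentPolynomial n →ₗ[ℂ] SectionSpace n :=
  DirectSum.toModule ℂ ℕ (SectionSpace n) fun k =>
    DirectSum.lof ℂ ℕ (fun k : ℕ => H0 n k) k ∘ₗ specializeDegree n k c

end StarCP

end

/-!
# The star product on the sections of `O(k)` over complex projective space

A holomorphic function on `ℂⁿ⁺¹ ∖ {0}` that is homogeneous of degree `k ≥ 0` is a homogeneous
polynomial (`IsPuncturedHomogeneous.exists_mvPolynomial`): on a complex line that avoids the origin
it is entire of growth `k`, hence a polynomial, so that its partial derivatives are combinations of
translates and are again holomorphic; Euler's identity and induction on `k` do the rest. Sections,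
coefficients `Λ` and bidifferential operators `B_p` thus live in a polynomial ring, where `B_p`
vanishes on arguments of degree less than `p`. This is why the star product is a finite sum.

The main point is that the brackets `T^{a,b,d} = {Λ^{a,b}, Z_d} = ∑_c Λ^{c,d} ∂_c Λ^{a,b}` vanish
(`hamDeriv_eq_zero`). The ordering relation of order two, applied to a linear function and a
quadratic one, makes `T` a trivector. The Jacobi rule for the affine coordinates `Z_a / Z_i`, which
only concerns functions of degree zero, says that the exterior product of `T` with the Euler field
`E` is zero, hence that `T = E ∧ S` for a bivector `S`. The expression
`∑_f T^{d,e,f} ∂_f Λ^{a,b} = {Λ^{d,e}, Λ^{a,b}}` changes its sign if the two pairs are exchanged. On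
covectors that annihilate `E` it equals `2 S^{d,e} Λ^{a,b}`, by Euler's identity. So `S ⊗ Λ` is skew
there, which forces `S = 0`, unless `Λ` vanishes there; in that case `T` is computed directly
(`trivector_eq_zero`).

Since the vector fields `∑_c Λ^{c,d} ∂_c` annihilate the coefficients, these behave like constants
in the iterated operators, and the two ways to bracket a triple product agree in every order, as they
do for the Moyal product (`sum_choose_bidiffPower_assoc`): both equal a power of the sum of the three
operators that act on two of the three factors. Associativity for formal series and for scalar values
of the parameter, and the multiplicativity of the substitution, follow by rearranging finite sums.
The coordinates `Z_a`, `Z_b` with `Λ^{a,b} ≠ 0` do not commute.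
-/

noncomputable section

namespace StarCP

section

open Filter Topology MvPolynomial

/-- Polynomials in the homogeneous coordinates. -/
abbrev Poly (n : ℕ) : Type := MvPolynomial (Fin (n + 1)) ℂ

/-! ### Entire functions of polynomial growth -/

/-- Liouville's theorem for entire functions of polynomial growth. -/
theorem exists_polynomial_of_tendsto_div_pow (k : ℕ) {φ : ℂ → ℂ} {L : ℂ} (hφ : Differentiable ℂ φ)
    (h : Tendsto (fun t => φ t / t ^ k) (cocompact ℂ) (𝓝 L)) :
    ∃ p : Polynomial ℂ, p.natDegree ≤ k ∧ ∀ t, φ t = p.eval t := by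
  induction k generalizing φ with
  | zero =>
    simp only [pow_zero, div_one] at h
    exact ⟨Polynomial.C L, by simp, fun t => by simp [hφ.apply_eq_of_tendsto_cocompact t h]⟩
  | succ k ih =>
    have hψ : Differentiable ℂ (dslope φ 0) := by
      rw [← differentiableOn_univ, Complex.differentiableOn_dslope univ_mem]
      exact hφ.differentiableOn
    have h0 : Tendsto (fun t : ℂ => φ 0 * (t⁻¹) ^ (k + 1)) (cocompact ℂ) (𝓝 0) := by
      have h1 : Tendsto (fun t : ℂ => t⁻¹) (cocompact ℂ) (𝓝 0) := by
        rw [← Metric.cobounded_eq_cocompact]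
        exact tendsto_inv₀_cobounded
      simpa using (h1.pow (k + 1)).const_mul (φ 0)
    have hne : ∀ᶠ t : ℂ in cocompact ℂ, t ≠ 0 :=
      (isCompact_singleton (x := (0 : ℂ))).compl_mem_cocompact
    obtain ⟨p, hp, hpe⟩ := ih hψ <| by
      refine (sub_zero L ▸ h.sub h0).congr' ?_
      filter_upwards [hne] with t ht
      rw [dslope_of_ne _ ht, slope_def_field, inv_pow, ← div_eq_mul_inv, ← sub_div, sub_zero,
        div_div, pow_succ']
    refine ⟨Polynomial.C (φ 0) + Polynomial.X * p, ?_, fun t => ?_⟩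
    · refine (Polynomial.natDegree_add_le _ _).trans (max_le (by simp) ?_)
      exact Polynomial.natDegree_mul_le.trans (by rw [Polynomial.natDegree_X]; omega)
    · have := sub_smul_dslope φ 0 t
      simp only [sub_zero, smul_eq_mul] at this
      simp [← hpe, this]

/-- The derivative at `0` of a polynomial of degree at most `k` is a fixed linear combination of
its values at `0, …, k`. -/
theorem exists_derivative_eval_zero_eq_sum (k : ℕ) :
    ∃ c : ℕ → ℂ, ∀ p : Polynomial ℂ, p.natDegree ≤ k →
      p.derivative.eval 0 = ∑ i ∈ Finset.range (k + 1), c i * p.eval (i : ℂ) := by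
  refine ⟨fun i => (Lagrange.basis (Finset.range (k + 1)) (fun i : ℕ => (i : ℂ)) i).derivative.eval
    0, fun p hp => ?_⟩
  have hinj : Set.InjOn (fun i : ℕ => (i : ℂ)) (Finset.range (k + 1)) :=
    fun _ _ _ _ h => Nat.cast_injective h
  have hdeg : p.degree < (Finset.range (k + 1)).card := by
    rw [Finset.card_range]
    exact Polynomial.degree_lt_iff_coeff_zero _ _ |>.2 fun m hm =>
      Polynomial.coeff_eq_zero_of_natDegree_lt (by omega)
  conv_lhs => rw [Lagrange.eq_interpolate hinj hdeg, Lagrange.interpolate_apply]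
  simp [Polynomial.eval_finsetSum, mul_comm]

/-! ### Homogeneous holomorphic functions are polynomials -/

/-- `f` is holomorphic and homogeneous of degree `k` on `ℂⁿ⁺¹ ∖ {0}`. Its value at `0` is
irrelevant. -/
structure IsPuncturedHomogeneous {n : ℕ} (k : ℕ) (f : Coord n → ℂ) : Prop where
  differentiableAt : ∀ z, z ≠ 0 → DifferentiableAt ℂ f z
  map_smul : ∀ z, z ≠ 0 → ∀ t : ℂ, t ≠ 0 → f (t • z) = t ^ k * f z

variable {n k : ℕ} {f : Coord n → ℂ}

theorem add_smul_ne_zero {z w : Coord n} (hzw : z ∉ Submodule.span ℂ {w}) (t : ℂ) :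
    z + t • w ≠ 0 := fun h =>
  hzw <| Submodule.mem_span_singleton.2 ⟨-t, by
    rw [neg_smul]
    exact (eq_neg_of_add_eq_zero_left h).symm⟩

namespace IsPuncturedHomogeneous

theorem differentiable_line (hf : IsPuncturedHomogeneous k f) {z w : Coord n}
    (hzw : z ∉ Submodule.span ℂ {w}) : Differentiable ℂ fun t : ℂ => f (z + t • w) := fun t =>
  (hf.differentiableAt _ (add_smul_ne_zero hzw t)).comp t (by fun_prop)

/-- On a complex line that avoids the origin, `f` grows like the `k`-th power. -/
theorem tendsto_line (hf : IsPuncturedHomogeneous k f) {z w : Coord n} (hw : w ≠ 0)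
    (hzw : z ∉ Submodule.span ℂ {w}) :
    Tendsto (fun t : ℂ => f (z + t • w) / t ^ k) (cocompact ℂ) (𝓝 (f w)) := by
  have h1 : Tendsto (fun t : ℂ => t⁻¹) (cocompact ℂ) (𝓝 0) := by
    rw [← Metric.cobounded_eq_cocompact]
    exact tendsto_inv₀_cobounded
  have h2 : Tendsto (fun t : ℂ => t⁻¹ • z + w) (cocompact ℂ) (𝓝 w) := by
    simpa using (h1.smul_const z).add_const w
  have hne : ∀ᶠ t : ℂ in cocompact ℂ, t ≠ 0 :=
    (isCompact_singleton (x := (0 : ℂ))).compl_mem_cocompact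
  refine ((hf.differentiableAt w hw).continuousAt.tendsto.comp h2).congr' ?_
  filter_upwards [hne] with t ht
  rw [Function.comp_apply, eq_div_iff (pow_ne_zero k ht), mul_comm, ← hf.map_smul _ _ t ht]
  · rw [smul_add, smul_inv_smul₀ ht]
  · intro h
    apply add_smul_ne_zero hzw t
    rw [← smul_inv_smul₀ ht z, ← smul_add, h, smul_zero]

/-- The derivative of `f` in the direction `w` is a linear combination of translates of `f`. -/
theorem exists_fderiv_eq_sum (hf : IsPuncturedHomogeneous k f) {w : Coord n} (hw : w ≠ 0) :
    ∃ c : ℕ → ℂ, ∀ z, z ∉ Submodule.span ℂ {w} →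
      fderiv ℂ f z w = ∑ i ∈ Finset.range (k + 1), c i * f (z + (i : ℂ) • w) := by
  obtain ⟨c, hc⟩ := exists_derivative_eval_zero_eq_sum k
  refine ⟨c, fun z hz => ?_⟩
  obtain ⟨p, hp, hpe⟩ := exists_polynomial_of_tendsto_div_pow k (hf.differentiable_line hz)
    (hf.tendsto_line hw hz)
  have hz0 : z ≠ 0 := by simpa using add_smul_ne_zero hz 0
  have h1 : HasDerivAt (fun t : ℂ => f (z + t • w)) (fderiv ℂ f z w) 0 := by
    have hl : HasDerivAt (fun t : ℂ => z + t • w) w 0 := by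
      simpa using ((hasDerivAt_id (0 : ℂ)).smul_const w).const_add z
    have hf' : HasFDerivAt f (fderiv ℂ f z) (z + (0 : ℂ) • w) := by
      simpa using (hf.differentiableAt z hz0).hasFDerivAt
    exact hf'.comp_hasDerivAt (0 : ℂ) hl
  have h2 : HasDerivAt (fun t : ℂ => f (z + t • w)) (p.derivative.eval 0) 0 := by
    simp only [hpe]
    exact p.hasDerivAt 0
  rw [h1.unique h2, hc p hp]
  simp [hpe]

theorem differentiableAt_fderiv_of_notMem_span (hf : IsPuncturedHomogeneous k f) {z w : Coord n}
    (hw : w ≠ 0) (hz : z ∉ Submodule.span ℂ {w}) :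
    DifferentiableAt ℂ (fun y => fderiv ℂ f y w) z := by
  obtain ⟨c, hc⟩ := hf.exists_fderiv_eq_sum hw
  have hopen : ∀ᶠ y in 𝓝 z, y ∉ Submodule.span ℂ {w} :=
    (Submodule.closed_of_finiteDimensional (Submodule.span ℂ {w})).isOpen_compl.mem_nhds hz
  have hd : DifferentiableAt ℂ
      (fun y => ∑ i ∈ Finset.range (k + 1), c i * f (y + (i : ℂ) • w)) z := by
    refine DifferentiableAt.fun_sum fun i _ => DifferentiableAt.const_mul ?_ _
    exact (hf.differentiableAt _ (add_smul_ne_zero hz i)).comp z (by fun_prop)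
  exact hd.congr_of_eventuallyEq (hopen.mono hc)

/-- In dimension at least two, the partial derivatives of `f` are again holomorphic. -/
theorem differentiableAt_partialZ (hn : n ≠ 0) (hf : IsPuncturedHomogeneous k f)
    (α : Fin (n + 1)) {z : Coord n} (hz : z ≠ 0) : DifferentiableAt ℂ (partialZ α f) z := by
  by_cases h : z ∈ Submodule.span ℂ {(Pi.single α 1 : Coord n)}
  · -- If `z` is parallel to `e_α`, then it is parallel to neither `e_α + e_β` nor `e_β`.
    obtain ⟨β, hβ⟩ : ∃ β, β ≠ α := by
      have : Nontrivial (Fin (n + 1)) := Fin.nontrivial_iff_two_le.2 (by omega)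
      exact exists_ne α
    obtain ⟨s, rfl⟩ := Submodule.mem_span_singleton.1 h
    have hs : s ≠ 0 := by rintro rfl; simp at hz
    have h1 : s • (Pi.single α 1 : Coord n) ∉
        Submodule.span ℂ {(Pi.single α 1 + Pi.single β 1 : Coord n)} := by
      intro h'
      obtain ⟨t, ht⟩ := Submodule.mem_span_singleton.1 h'
      have ha := congrFun ht α
      have hb := congrFun ht β
      simp [hβ.symm, hβ] at ha hb
      exact hs (by rw [← ha, hb])
    have h2 : s • (Pi.single α 1 : Coord n) ∉ Submodule.span ℂ {(Pi.single β 1 : Coord n)} := by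
      intro h'
      obtain ⟨t, ht⟩ := Submodule.mem_span_singleton.1 h'
      have ha := congrFun ht α
      simp [hβ.symm] at ha
      exact hs ha.symm
    have h3 : (Pi.single α 1 + Pi.single β 1 : Coord n) ≠ 0 := fun h0 => by
      have := congrFun h0 β
      simp [hβ] at this
    have h4 : (Pi.single β 1 : Coord n) ≠ 0 := fun h0 => by
      have := congrFun h0 β
      simp at this
    have := (hf.differentiableAt_fderiv_of_notMem_span h3 h1).sub
      (hf.differentiableAt_fderiv_of_notMem_span h4 h2)
    refine this.congr_of_eventuallyEq (Eventually.of_forall fun y => ?_)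
    simp [partialZ]
  · refine hf.differentiableAt_fderiv_of_notMem_span (fun h0 => ?_) h
    have := congrFun h0 α
    simp at this

theorem partialZ (hn : n ≠ 0) (hf : IsPuncturedHomogeneous (k + 1) f) (α : Fin (n + 1)) :
    IsPuncturedHomogeneous k (partialZ α f) where
  differentiableAt _ hz := hf.differentiableAt_partialZ hn α hz
  map_smul z hz t ht := by
    have hzt : t • z ≠ 0 := smul_ne_zero ht hz
    have h1 : HasFDerivAt (fun y => f (t • y)) (t • fderiv ℂ f (t • z)) z := by
      have hl : HasFDerivAt (fun y : Coord n => t • y) (t • ContinuousLinearMap.id ℂ (Coord n)) z :=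
        (hasFDerivAt_id z).const_smul t
      have hc : (fderiv ℂ f (t • z)).comp (t • ContinuousLinearMap.id ℂ (Coord n))
          = t • fderiv ℂ f (t • z) := by
        ext v
        simp
      rw [← hc]
      exact HasFDerivAt.comp z (hf.differentiableAt _ hzt).hasFDerivAt hl
    have h2 : HasFDerivAt (fun y => f (t • y)) (t ^ (k + 1) • fderiv ℂ f z) z := by
      have hd := (hf.differentiableAt z hz).hasFDerivAt.const_mul (t ^ (k + 1))
      refine hd.congr_of_eventuallyEq ?_
      filter_upwards [isOpen_ne.mem_nhds hz] with y hy
      exact hf.map_smul y hy t ht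
    have h3 := congrArg (fun A : Coord n →L[ℂ] ℂ => A (Pi.single α 1)) (h1.unique h2)
    simp only [_root_.smul_apply, smul_eq_mul] at h3
    rw [StarCP.partialZ, StarCP.partialZ]
    apply mul_left_cancel₀ ht
    rw [h3]
    ring

/-- Euler's identity. -/
theorem sum_mul_partialZ (hf : IsPuncturedHomogeneous k f) {z : Coord n} (hz : z ≠ 0) :
    ∑ α, z α * StarCP.partialZ α f z = k * f z := by
  have h1 : HasDerivAt (fun t : ℂ => f (t • z)) (fderiv ℂ f z z) 1 := by
    have hl : HasDerivAt (fun t : ℂ => t • z) z 1 := by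
      simpa using (hasDerivAt_id (1 : ℂ)).smul_const z
    have hf' : HasFDerivAt f (fderiv ℂ f z) ((1 : ℂ) • z) := by
      simpa using (hf.differentiableAt z hz).hasFDerivAt
    exact hf'.comp_hasDerivAt (1 : ℂ) hl
  have h2 : HasDerivAt (fun t : ℂ => f (t • z)) (k * f z) 1 := by
    have : HasDerivAt (fun t : ℂ => t ^ k * f z) (k * f z) 1 := by
      simpa using (hasDerivAt_pow k (1 : ℂ)).mul_const (f z)
    refine this.congr_of_eventuallyEq ?_
    filter_upwards [isOpen_ne.mem_nhds (one_ne_zero (α := ℂ))] with t ht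
    exact hf.map_smul z hz t ht
  rw [← h1.unique h2]
  conv_rhs => arg 2; rw [pi_eq_sum_univ' z]
  simp [StarCP.partialZ, map_sum]

/-- The proof is by induction on the degree, with Euler's identity. In dimension one, where the partial
derivative of a constant would be of negative degree, the homogeneity alone is enough. -/
theorem exists_mvPolynomial (hf : IsPuncturedHomogeneous k f) :
    ∃ F : Poly n, F.IsHomogeneous k ∧ ∀ z, z ≠ 0 → f z = eval z F := by
  by_cases hn : n = 0
  · subst hn
    refine ⟨C (f 1) * X 0 ^ k, isHomogeneous_C_mul_X_pow _ _ _, fun z hz => ?_⟩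
    have hz0 : z 0 ≠ 0 := fun h => hz (funext fun i => by rwa [Fin.fin_one_eq_zero i])
    have hz1 : z = z 0 • (1 : Coord 0) := funext fun i => by
      simp [Fin.fin_one_eq_zero i]
    conv_lhs => rw [hz1, hf.map_smul _ one_ne_zero _ hz0]
    simp [mul_comm]
  induction k generalizing f with
  | zero =>
    have he : (Pi.single 0 1 : Coord n) ≠ 0 := fun h0 => by
      have := congrFun h0 0
      simp at this
    refine ⟨C (f (Pi.single 0 1)), isHomogeneous_C _ _, fun z hz => ?_⟩
    rw [eval_C]
    by_cases h : z ∈ Submodule.span ℂ {(Pi.single 0 1 : Coord n)}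
    · obtain ⟨s, rfl⟩ := Submodule.mem_span_singleton.1 h
      have hs : s ≠ 0 := by rintro rfl; simp at hz
      simpa using hf.map_smul _ he s hs
    · have := (hf.differentiable_line h).apply_eq_of_tendsto_cocompact 0
        (by simpa using hf.tendsto_line he h)
      simpa using this
  | succ k ih =>
    choose F hF hFe using fun α => ih (hf.partialZ hn α)
    refine ⟨C ((k + 1 : ℂ)⁻¹) * ∑ α, X α * F α, ?_, fun z hz => ?_⟩
    · refine (IsHomogeneous.sum _ _ _ fun α _ => ?_).C_mul _
      rw [add_comm k 1]
      exact (isHomogeneous_X _ α).mul (hF α)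
    · have h := hf.sum_mul_partialZ hz
      have hk : (k + 1 : ℂ) ≠ 0 := by exact_mod_cast Nat.succ_ne_zero k
      push_cast at h
      rw [map_mul, eval_C, map_sum, eq_inv_mul_iff_mul_eq₀ hk, ← h]
      exact Finset.sum_congr rfl fun α _ => by rw [map_mul, eval_X, hFe α z hz]

end IsPuncturedHomogeneous

theorem isPuncturedHomogeneous_of_mem_H0 (hf : f ∈ H0 n k) : IsPuncturedHomogeneous k f where
  differentiableAt z hz := by
    refine (hf.1 z (mem_cone_univ.2 hz)).differentiableAt ?_
    filter_upwards [isOpen_ne.mem_nhds hz] with y hy using mem_cone_univ.2 hy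
  map_smul z hz t ht := by simpa using hf.2.1 z (mem_cone_univ.2 hz) t ht

end

section

/-! ### Powers of a bidifferential operator whose coefficients are constant along it -/

section BidiffPower

variable {𝕜 A ι : Type*} [CommRing 𝕜] [CommRing A] [Algebra 𝕜 A] [Fintype ι]

/-- The bidifferential operator
`∑ L^{a_1,b_1} ⋯ L^{a_k,b_k} (D_{a_1} ⋯ D_{a_k} x) (D_{b_1} ⋯ D_{b_k} y)` on a commutative algebra
with derivations `D_a`, as a bilinear map, defined by recursion on `k`. -/
def bidiffPower (D : ι → Derivation 𝕜 A A) (L : ι → ι → A) : ℕ → A →ₗ[𝕜] A →ₗ[𝕜] A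
  | 0 => LinearMap.mul 𝕜 A
  | k + 1 => ∑ a, ∑ b, ((bidiffPower D L k).compl₁₂ (D a : A →ₗ[𝕜] A) (D b : A →ₗ[𝕜] A)).compr₂
      (LinearMap.mulLeft 𝕜 (L a b))

variable (D : ι → Derivation 𝕜 A A) (L : ι → ι → A)

@[simp]
theorem bidiffPower_zero (x y : A) : bidiffPower D L 0 x y = x * y := rfl

theorem bidiffPower_succ (k : ℕ) (x y : A) :
    bidiffPower D L (k + 1) x y = ∑ a, ∑ b, L a b * bidiffPower D L k (D a x) (D b y) := by
  simp [bidiffPower, LinearMap.sum_apply]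

theorem bidiffPower_one_right (k : ℕ) (x : A) :
    bidiffPower D L k x 1 = if k = 0 then x else 0 := by
  cases k <;> simp [bidiffPower_succ]

theorem bidiffPower_one_left (k : ℕ) (x : A) :
    bidiffPower D L k 1 x = if k = 0 then x else 0 := by
  cases k <;> simp [bidiffPower_succ]

variable {D L}

theorem bidiffPower_swap (hskew : ∀ a b, L a b = -L b a) (k : ℕ) (x y : A) :
    bidiffPower D L k y x = (-1) ^ k * bidiffPower D L k x y := by
  induction k generalizing x y with
  | zero => simp [mul_comm]
  | succ k ih =>
    rw [bidiffPower_succ, bidiffPower_succ, Finset.sum_comm, Finset.mul_sum]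
    refine Finset.sum_congr rfl fun a _ => ?_
    rw [Finset.mul_sum]
    refine Finset.sum_congr rfl fun b _ => ?_
    rw [ih, hskew b a]
    ring

variable (hL : ∀ a b d, ∑ c, L c d * D c (L a b) = 0)
include hL

/-- The coefficients `L^{a,b}` can be pulled out of the bidifferential operator. -/
theorem bidiffPower_mul_left (k : ℕ) {u : A} (hu : ∀ d, ∑ c, L c d * D c u = 0) (x y : A) :
    bidiffPower D L k (u * x) y = u * bidiffPower D L k x y := by
  induction k generalizing u x y with
  | zero => simp [mul_assoc]
  | succ k ih =>
    have h1 : ∀ b, ∑ a, L a b * bidiffPower D L k (x * D a u) (D b y) = 0 := fun b => by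
      have h2 : ∀ a, L a b * bidiffPower D L k (x * D a u) (D b y)
          = bidiffPower D L k (x * (L a b * D a u)) (D b y) := fun a => by
        rw [← ih (hL a b)]
        congr 2
        ring
      rw [Finset.sum_congr rfl fun a _ => h2 a, ← LinearMap.sum_apply, ← map_sum,
        ← Finset.mul_sum, hu, mul_zero, map_zero, LinearMap.zero_apply]
    rw [bidiffPower_succ, bidiffPower_succ, Finset.mul_sum]
    simp only [Derivation.leibniz, smul_eq_mul, map_add, LinearMap.add_apply, mul_add,
      Finset.sum_add_distrib, ih hu]
    rw [add_eq_left.2]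
    · refine Finset.sum_congr rfl fun a _ => ?_
      rw [Finset.mul_sum]
      exact Finset.sum_congr rfl fun b _ => by ring
    · rw [Finset.sum_comm]
      exact Finset.sum_eq_zero fun b _ => h1 b

/-- The vector fields `∑ L^{a,d} D_a` act on the bidifferential operator by the Leibniz rule in its
two arguments, since they annihilate the coefficients. -/
theorem sum_mul_derivation_bidiffPower (hD : ∀ a b x, D a (D b x) = D b (D a x)) (k : ℕ) (d : ι)
    (x y : A) :
    ∑ a, L a d * D a (bidiffPower D L k x y)
      = ∑ a, L a d * (bidiffPower D L k (D a x) y + bidiffPower D L k x (D a y)) := by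
  induction k generalizing x y with
  | zero => simp [mul_add, add_comm, mul_comm]
  | succ k ih =>
    have h1 : ∀ a, L a d * D a (bidiffPower D L (k + 1) x y)
        = (∑ b, ∑ c, L b c * (L a d * D a (bidiffPower D L k (D b x) (D c y))))
          + ∑ b, ∑ c, bidiffPower D L k (D b x) (D c y) * (L a d * D a (L b c)) := fun a => by
      rw [bidiffPower_succ, map_sum, Finset.mul_sum, ← Finset.sum_add_distrib]
      refine Finset.sum_congr rfl fun b _ => ?_
      rw [map_sum, Finset.mul_sum, ← Finset.sum_add_distrib]
      refine Finset.sum_congr rfl fun c _ => ?_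
      rw [Derivation.leibniz, smul_eq_mul, smul_eq_mul]
      ring
    have h2 : ∑ a, ∑ b, ∑ c, bidiffPower D L k (D b x) (D c y) * (L a d * D a (L b c)) = 0 := by
      rw [Finset.sum_comm]
      refine Finset.sum_eq_zero fun b _ => ?_
      rw [Finset.sum_comm]
      refine Finset.sum_eq_zero fun c _ => ?_
      rw [← Finset.mul_sum, hL, mul_zero]
    have h3 : ∑ a, ∑ b, ∑ c, L b c * (L a d * D a (bidiffPower D L k (D b x) (D c y)))
        = ∑ a, ∑ b, ∑ c, L b c * (L a d * (bidiffPower D L k (D b (D a x)) (D c y)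
            + bidiffPower D L k (D b x) (D c (D a y)))) := by
      rw [Finset.sum_comm]
      conv_rhs => rw [Finset.sum_comm]
      refine Finset.sum_congr rfl fun b _ => ?_
      rw [Finset.sum_comm]
      conv_rhs => rw [Finset.sum_comm]
      refine Finset.sum_congr rfl fun c _ => ?_
      rw [← Finset.mul_sum, ← Finset.mul_sum, ih]
      simp only [hD]
    rw [Finset.sum_congr rfl fun a _ => h1 a, Finset.sum_add_distrib, h2, add_zero, h3]
    refine Finset.sum_congr rfl fun a _ => ?_
    rw [bidiffPower_succ, bidiffPower_succ, ← Finset.sum_add_distrib, Finset.mul_sum]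
    refine Finset.sum_congr rfl fun b _ => ?_
    rw [← Finset.sum_add_distrib, Finset.mul_sum]
    refine Finset.sum_congr rfl fun c _ => ?_
    ring

omit hL in
/-- The `N`-th power of the sum of the three operators which let the two derivatives of
`∑ L^{a,b} D_a ⊗ D_b` act on two of the three factors of a product, in their order. -/
def tridiffPower (D : ι → Derivation 𝕜 A A) (L : ι → ι → A) : ℕ → A → A → A → A
  | 0, x, y, z => x * y * z
  | N + 1, x, y, z => ∑ a, ∑ b, L a b * (tridiffPower D L N (D a x) (D b y) z
      + tridiffPower D L N (D a x) y (D b z) + tridiffPower D L N x (D a y) (D b z))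

omit hL in
theorem tridiffPower_swap (hskew : ∀ a b, L a b = -L b a) (N : ℕ) (x y z : A) :
    tridiffPower D L N z y x = (-1) ^ N * tridiffPower D L N x y z := by
  induction N generalizing x y z with
  | zero => simp only [tridiffPower, pow_zero]; ring
  | succ N ih =>
    rw [tridiffPower, tridiffPower, Finset.sum_comm, Finset.mul_sum]
    refine Finset.sum_congr rfl fun a _ => ?_
    rw [Finset.mul_sum]
    refine Finset.sum_congr rfl fun b _ => ?_
    rw [ih x (D a y) (D b z), ih (D a x) y (D b z), ih (D a x) (D b y) z, hskew b a]
    ring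

/-- The iterated products of total order `N`, bracketed to the left. -/
theorem sum_choose_bidiffPower_left (hD : ∀ a b x, D a (D b x) = D b (D a x)) (N : ℕ) (x y z : A) :
    ∑ p ∈ Finset.HasAntidiagonal.antidiagonal N, (N.choose p.1 : A) *
        bidiffPower D L p.2 (bidiffPower D L p.1 x y) z = tridiffPower D L N x y z := by
  induction N generalizing x y z with
  | zero => simp [tridiffPower]
  | succ N ih =>
    have h1 : ∀ p q, bidiffPower D L q (bidiffPower D L (p + 1) x y) z
        = ∑ a, ∑ b, L a b * bidiffPower D L q (bidiffPower D L p (D a x) (D b y)) z := by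
      intro p q
      rw [bidiffPower_succ, map_sum, LinearMap.sum_apply]
      refine Finset.sum_congr rfl fun a _ => ?_
      rw [map_sum, LinearMap.sum_apply]
      exact Finset.sum_congr rfl fun b _ => bidiffPower_mul_left hL q (hL a b) _ _
    have h2 : ∀ p q, bidiffPower D L (q + 1) (bidiffPower D L p x y) z
        = ∑ a, ∑ b, L a b * (bidiffPower D L q (bidiffPower D L p (D a x) y) (D b z)
          + bidiffPower D L q (bidiffPower D L p x (D a y)) (D b z)) := by
      intro p q
      rw [bidiffPower_succ, Finset.sum_comm]
      conv_rhs => rw [Finset.sum_comm]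
      refine Finset.sum_congr rfl fun b _ => ?_
      have h3 : ∀ w : A, ∀ a, L a b * bidiffPower D L q w (D b z)
          = bidiffPower D L q (L a b * w) (D b z) :=
        fun w a => (bidiffPower_mul_left hL q (hL a b) _ _).symm
      simp only [h3, ← LinearMap.add_apply, ← map_add]
      simp only [← LinearMap.sum_apply, ← map_sum]
      rw [sum_mul_derivation_bidiffPower hL hD]
    rw [tridiffPower, Finset.sum_antidiagonal_choose_succ_mul
      (fun p q => bidiffPower D L q (bidiffPower D L p x y) z)]
    simp only [← ih, h1, h2, Finset.mul_sum]
    rw [Finset.sum_comm, Finset.sum_comm (s := Finset.HasAntidiagonal.antidiagonal N),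
      ← Finset.sum_add_distrib]
    refine Finset.sum_congr rfl fun a _ => ?_
    rw [Finset.sum_comm, Finset.sum_comm (s := Finset.HasAntidiagonal.antidiagonal N),
      ← Finset.sum_add_distrib]
    refine Finset.sum_congr rfl fun b _ => ?_
    rw [← Finset.sum_add_distrib, ← Finset.sum_add_distrib, ← Finset.sum_add_distrib,
      Finset.mul_sum]
    refine Finset.sum_congr rfl fun p hp => ?_
    obtain rfl := Finset.HasAntidiagonal.mem_antidiagonal.1 hp
    rw [Nat.choose_symm_add]
    ring

/-- Associativity of the star product in each order. -/
theorem sum_choose_bidiffPower_assoc (hD : ∀ a b x, D a (D b x) = D b (D a x))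
    (hskew : ∀ a b, L a b = -L b a) (N : ℕ) (x y z : A) :
    ∑ p ∈ Finset.HasAntidiagonal.antidiagonal N, (N.choose p.1 : A) *
        bidiffPower D L p.2 (bidiffPower D L p.1 x y) z
      = ∑ p ∈ Finset.HasAntidiagonal.antidiagonal N, (N.choose p.1 : A) *
        bidiffPower D L p.1 x (bidiffPower D L p.2 y z) := by
  have h : tridiffPower D L N x y z = (-1) ^ N * tridiffPower D L N z y x :=
    tridiffPower_swap hskew N z y x
  rw [sum_choose_bidiffPower_left hL hD, h, ← sum_choose_bidiffPower_left hL hD, Finset.mul_sum,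
    ← Finset.Nat.sum_antidiagonal_swap]
  refine Finset.sum_congr rfl fun p hp => ?_
  obtain rfl := Finset.HasAntidiagonal.mem_antidiagonal.1 hp
  have h2 : bidiffPower D L p.2 z y = (-1) ^ p.2 * bidiffPower D L p.2 y z :=
    bidiffPower_swap hskew _ _ _
  have h3 : ∀ w : A, bidiffPower D L p.1 ((-1) ^ p.2 * w) x
      = (-1) ^ p.2 * bidiffPower D L p.1 w x :=
    fun w => bidiffPower_mul_left hL _ (fun d => by simp [Derivation.leibniz_pow]) _ _
  have h4 : (-1 : A) ^ p.1 * (-1) ^ p.1 = 1 := by rw [← mul_pow]; simp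
  have h5 : (-1 : A) ^ p.2 * (-1) ^ p.2 = 1 := by rw [← mul_pow]; simp
  rw [Prod.fst_swap, Prod.snd_swap, h2, h3, bidiffPower_swap hskew p.1 x, Nat.choose_symm_add,
    pow_add]
  linear_combination (Nat.choose (p.1 + p.2) p.2 : A) *
    bidiffPower D L p.1 x (bidiffPower D L p.2 y z) * ((-1 : A) ^ p.2 * (-1) ^ p.2 * h4 + h5)

end BidiffPower

end

section

open Filter Topology MvPolynomial

variable {n : ℕ}

/-! ### Partial derivatives of polynomial functions -/

theorem hasFDerivAt_eval (F : Poly n) (z : Coord n) :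
    HasFDerivAt (fun y : Coord n => eval y F)
      (∑ α, eval z (pderiv α F) • ContinuousLinearMap.proj (R := ℂ) (φ := fun _ => ℂ) α) z := by
  induction F using MvPolynomial.induction_on with
  | C a =>
    simp only [eval_C]
    refine (hasFDerivAt_const a z).congr_fderiv ?_
    ext v
    simp
  | add p q hp hq =>
    have h : HasFDerivAt (fun y : Coord n => eval y p + eval y q) _ z := hp.add hq
    simp only [map_add]
    refine h.congr_fderiv ?_
    ext v
    simp [add_mul, Finset.sum_add_distrib]
  | mul_X p i hp =>
    have h : HasFDerivAt (fun y : Coord n => eval y p * y i) _ z :=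
      hp.mul (hasFDerivAt_apply (𝕜 := ℂ) (F' := fun _ : Fin (n + 1) => ℂ) i z)
    simp only [map_mul, eval_X]
    refine h.congr_fderiv ?_
    ext v
    simp [Derivation.leibniz, pderiv_X, Pi.single_apply, add_mul, Finset.sum_add_distrib,
      Finset.mul_sum, mul_assoc, apply_ite]

theorem partialZ_eval (α : Fin (n + 1)) (F : Poly n) (z : Coord n) :
    partialZ α (fun y => eval y F) z = eval z (pderiv α F) := by
  rw [partialZ, (hasFDerivAt_eval F z).fderiv]
  simp [Pi.single_apply]

theorem partialZ_congr {f g : Coord n → ℂ} {z : Coord n} (h : f =ᶠ[𝓝 z] g) (α : Fin (n + 1)) :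
    partialZ α f z = partialZ α g z := by
  rw [partialZ, partialZ, h.fderiv_eq]

/-- A function that agrees with a polynomial off the origin has the partial derivatives of this
polynomial there. -/
theorem partialZ_eq_eval {f : Coord n → ℂ} {F : Poly n}
    (h : ∀ z, z ≠ 0 → f z = eval z F) (α : Fin (n + 1)) (z : Coord n) (hz : z ≠ 0) :
    partialZ α f z = eval z (pderiv α F) := by
  rw [← partialZ_eval]
  refine partialZ_congr ?_ α
  filter_upwards [isOpen_ne.mem_nhds hz] with y hy using h y hy

/-- The quotient rule with the denominator `z_i ^ m`. -/
theorem partialZ_eq_of_eventuallyEq_div {f : Coord n → ℂ} {F : Poly n}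
    {i : Fin (n + 1)} {m : ℕ} {z : Coord n} (hi : z i ≠ 0)
    (h : ∀ y : Coord n, y i ≠ 0 → f y = eval y F / y i ^ m) (α : Fin (n + 1)) :
    partialZ α f z = eval z (pderiv α F) / z i ^ m
      - m * (if α = i then 1 else 0) * eval z F / z i ^ (m + 1) := by
  have hopen : IsOpen {y : Coord n | y i ≠ 0} := isOpen_ne.preimage (continuous_apply i)
  have hz : z ≠ 0 := fun h0 => hi (by simp [h0])
  have hd : DifferentiableAt ℂ f z := by
    have hp : DifferentiableAt ℂ (fun y : Coord n => y i ^ m) z := by fun_prop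
    have : DifferentiableAt ℂ (fun y : Coord n => eval y F / y i ^ m) z :=
      by simpa only [div_eq_mul_inv] using
        (hasFDerivAt_eval F z).differentiableAt.fun_mul (hp.fun_inv (pow_ne_zero m hi))
    refine this.congr_of_eventuallyEq ?_
    filter_upwards [hopen.mem_nhds hi] with y hy using h y hy
  have h1 : HasFDerivAt (fun y : Coord n => y i ^ m * f y)
      (z i ^ m • fderiv ℂ f z + f z • ((m * z i ^ (m - 1)) •
        ContinuousLinearMap.proj (R := ℂ) (φ := fun _ => ℂ) i)) z := by
    have := (hasFDerivAt_apply (𝕜 := ℂ) (F' := fun _ : Fin (n + 1) => ℂ) i z).pow m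
    exact HasFDerivAt.mul (by simpa using this) hd.hasFDerivAt
  have h2 : partialZ α (fun y : Coord n => y i ^ m * f y) z = eval z (pderiv α F) := by
    rw [← partialZ_eval]
    refine partialZ_congr ?_ α
    filter_upwards [hopen.mem_nhds hi] with y hy
    rw [h y hy, mul_div_cancel₀ _ (pow_ne_zero m hy)]
  rw [partialZ, h1.fderiv] at h2
  simp only [_root_.add_apply, _root_.smul_apply, smul_eq_mul,
    ContinuousLinearMap.proj_apply, Pi.single_apply, h z hi] at h2
  rw [partialZ, ← h2]
  have hm : (m : ℂ) * z i ^ (m - 1) = m * z i ^ m / z i := by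
    cases m with
    | zero => simp
    | succ m => field_simp; simp [pow_succ]
  rw [hm]
  simp only [eq_comm (a := i)]
  field_simp
  ring

/-- The recursion for the operators `B_k`, splitting off the innermost derivatives. -/
theorem symbolPower_succ (Λ : Coeffs n) (k : ℕ) (f g : Coord n → ℂ) (z : Coord n) :
    symbolPower Λ (k + 1) f g z
      = ∑ a, ∑ b, Λ a b z * symbolPower Λ k (partialZ a f) (partialZ b g) z := by
  have hp : ∀ (v : Fin k → Fin (n + 1)) (a : Fin (n + 1)) (h : Coord n → ℂ),
      partials (List.ofFn (Fin.snoc v a : Fin (k + 1) → Fin (n + 1))) h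
        = partials (List.ofFn v) (partialZ a h) := by
    intro v a h
    rw [List.ofFn_succ', List.concat_eq_append]
    simp [partials]
  have hs : ∀ φ : (Fin (k + 1) → Fin (n + 1)) → ℂ,
      ∑ v, φ v = ∑ a, ∑ v : Fin k → Fin (n + 1), φ (Fin.snoc v a) := by
    intro φ
    rw [← (Fin.snocEquiv fun _ : Fin (k + 1) => Fin (n + 1)).sum_comp, Fintype.sum_prod_type]
    rfl
  simp only [symbolPower, Finset.mul_sum]
  rw [hs]
  refine Finset.sum_congr rfl fun a _ => ?_
  rw [Finset.sum_comm, hs]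
  refine Finset.sum_congr rfl fun b _ => ?_
  rw [Finset.sum_comm]
  refine Finset.sum_congr rfl fun v _ => Finset.sum_congr rfl fun w _ => ?_
  rw [hp, hp, Fin.prod_univ_castSucc]
  simp only [Fin.snoc_castSucc, Fin.snoc_last]
  ring

/-- On polynomials with polynomial coefficients, `B_k` is the algebraic bidifferential operator. -/
theorem symbolPower_eq_eval {Λ : Coeffs n} {L : Fin (n + 1) → Fin (n + 1) → Poly n}
    (hL : ∀ a b z, z ≠ 0 → Λ a b z = eval z (L a b)) (k : ℕ) {f g : Coord n → ℂ}
    {F G : Poly n} (hf : ∀ z, z ≠ 0 → f z = eval z F)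
    (hg : ∀ z, z ≠ 0 → g z = eval z G) (z : Coord n) (hz : z ≠ 0) :
    symbolPower Λ k f g z = eval z (bidiffPower (fun a => pderiv a) L k F G) := by
  induction k generalizing f g F G with
  | zero => simp [symbolPower, partials, hf z hz, hg z hz]
  | succ k ih =>
    rw [symbolPower_succ, bidiffPower_succ, map_sum]
    refine Finset.sum_congr rfl fun a _ => ?_
    rw [map_sum]
    refine Finset.sum_congr rfl fun b _ => ?_
    rw [ih (partialZ_eq_eval hf a) (partialZ_eq_eval hg b), hL a b z hz, map_mul]

/-! ### The consequences of the ordering relation and of the Jacobi rule -/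

/-- The second ordered power of a function `f` with vanishing second derivatives at `z` and a function
`g` with a critical point there. The only term left is the one in which `f` is hit once, the first
coefficient once and `g` twice. -/
theorem orderedPower_two (Λ : Coeffs n) (f g : Coord n → ℂ) (z : Coord n)
    (hf : ∀ α β, partialZ α (partialZ β f) z = 0) (hg : ∀ β, partialZ β g z = 0) :
    orderedPower Λ 2 f g z = ∑ a, ∑ c, ∑ b, ∑ d,
      partialZ a f z * partialZ c (Λ a b) z * Λ c d z * partialZ b (partialZ d g) z := by
  -- The slots that the derivatives to the left and to the right can hit.
  have h1 : (Finset.univ.filter fun a : Fin 2 → Fin (2 + 2) => ∀ i : Fin 2, a i < i.succ.castSucc)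
      = {![0, 0], ![0, 1]} := by decide
  have h2 : (Finset.univ.filter fun a : Fin 2 → Fin (2 + 2) => ∀ i : Fin 2, i.succ.castSucc < a i)
      = {![2, 3], ![3, 3]} := by decide
  have h3 : (![0, 0] : Fin 2 → Fin (2 + 2)) ∉ ({![0, 1]} : Finset (Fin 2 → Fin (2 + 2))) := by
    decide
  have h4 : (![2, 3] : Fin 2 → Fin (2 + 2)) ∉ ({![3, 3]} : Finset (Fin 2 → Fin (2 + 2))) := by
    decide
  have hs : ∀ φ : (Fin 2 → Fin (n + 1)) → ℂ, ∑ v, φ v = ∑ a, ∑ b, φ ![a, b] := by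
    intro φ
    rw [← (finTwoArrowEquiv (Fin (n + 1))).symm.sum_comp, Fintype.sum_prod_type]
    rfl
  rw [orderedPower, h1, h2]
  simp only [Finset.sum_insert h3, Finset.sum_insert h4, Finset.sum_singleton]
  simp only [hs, List.finRange_succ]
  have h5 : ∀ v : Fin 2 → Coord n → ℂ, (Fin.snoc v g : Fin 3 → Coord n → ℂ) 1 = v 1 := fun _ => rfl
  have h6 : ∀ v : Fin 2 → Coord n → ℂ, (Fin.snoc v g : Fin 3 → Coord n → ℂ) 2 = g := fun _ => rfl
  simp [Fin.prod_univ_succ, partials, hf, hg, h5, h6, mul_assoc]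

end

section

open Filter Topology MvPolynomial

variable {n : ℕ}

/-- The bracket `{Λ^{a,b}, Z_d} = ∑_c Λ^{c,d} ∂_c Λ^{a,b}`, for polynomial coefficients. -/
def hamDeriv (L : Fin (n + 1) → Fin (n + 1) → Poly n)
    (a b d : Fin (n + 1)) : Poly n :=
  ∑ c, L c d * pderiv c (L a b)

/-- The second ordering relation makes `∑_c Λ^{c,d} ∂_c Λ^{a,b}` skew in `b, d`. Together with the skew
symmetry in `a, b`, it is then a trivector. -/
theorem eval_hamDeriv_skew {Λ : Coeffs n}
    {L : Fin (n + 1) → Fin (n + 1) → Poly n}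
    (hL : ∀ a b z, z ≠ 0 → Λ a b z = eval z (L a b)) (hrel : OrderedRelation Λ)
    (a b d : Fin (n + 1)) (p : Coord n) (hp : p ≠ 0) :
    eval p (hamDeriv L a b d) = -eval p (hamDeriv L a d b) := by
  -- The linear function `Z_a` and a quadratic function with a critical point at `p`.
  set F : Poly n := X a with hF
  set G : Poly n := (X b - C (p b)) * (X d - C (p d)) with hG
  have hf : ∀ z : Coord n, z ≠ 0 → eval z F = eval z F := fun _ _ => rfl
  have hg : ∀ z : Coord n, z ≠ 0 → eval z G = eval z G := fun _ _ => rfl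
  have hf1 : ∀ α, partialZ α (fun z => eval z F) p = if a = α then 1 else 0 := fun α => by
    rw [partialZ_eval, hF, pderiv_X, Pi.single_apply]
    split_ifs <;> simp
  have hf2 : ∀ α β, partialZ α (partialZ β fun z => eval z F) p = 0 := fun α β => by
    rw [partialZ_eq_eval (partialZ_eq_eval hf β) α p hp, hF, pderiv_X, Pi.single_apply]
    split_ifs <;> simp
  have hg1 : ∀ β, partialZ β (fun z => eval z G) p = 0 := fun β => by
    rw [partialZ_eval, hG]
    simp [Derivation.leibniz]
  have hg2 : ∀ α β, partialZ α (partialZ β fun z => eval z G) p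
      = (if b = α then 1 else 0) * (if d = β then 1 else 0)
        + (if d = α then 1 else 0) * (if b = β then 1 else 0) := fun α β => by
    rw [partialZ_eq_eval (partialZ_eq_eval hg β) α p hp, hG]
    simp only [Derivation.leibniz, map_add, map_sub, pderiv_X, pderiv_C, smul_eq_mul,
      Pi.single_apply]
    split_ifs <;> simp
  have hdiff : ∀ F : Poly n, DifferentiableOn ℂ
      (fun z : Coord n => eval z F) {z | z ≠ 0} := fun F z _ =>
    (hasFDerivAt_eval F z).differentiableAt.differentiableWithinAt
  have h := hrel 2 {z | z ≠ 0} isOpen_ne (by simp) _ _ (hdiff F) (hdiff G) p hp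
  rw [orderedPower_two _ _ _ _ hf2 hg1, symbolPower_succ] at h
  have h0 : ∑ α, ∑ β, Λ α β p * symbolPower Λ 1 (partialZ α fun z => eval z F)
      (partialZ β fun z => eval z G) p = 0 := by
    refine Finset.sum_eq_zero fun α _ => Finset.sum_eq_zero fun β _ => ?_
    rw [symbolPower_succ, Finset.sum_eq_zero, mul_zero]
    intro γ _
    refine Finset.sum_eq_zero fun δ _ => ?_
    simp [symbolPower, partials, hf2]
  rw [h0] at h
  simp only [hf1, hg2, partialZ_eq_eval (hL _ _) _ p hp, hL _ _ p hp] at h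
  simp only [ite_mul, one_mul, zero_mul, mul_ite, mul_one, mul_zero, mul_add,
    Finset.sum_add_distrib, Finset.sum_ite_eq, Finset.mem_univ, if_true, Finset.sum_ite_irrel,
    Finset.sum_const_zero] at h
  simp only [hamDeriv, map_sum, map_mul]
  rw [eq_neg_iff_add_eq_zero, ← h]
  congr 1 <;> exact Finset.sum_congr rfl fun c _ => mul_comm _ _

/-- The affine chart `Z_i ≠ 0`. -/
def chart (n : ℕ) (i : Fin (n + 1)) : Set (CP n) := {p | p.rep i ≠ 0}

theorem mem_cone_chart {i : Fin (n + 1)} {z : Coord n} : z ∈ cone (chart n i) ↔ z i ≠ 0 := by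
  have h : ∀ hz : z ≠ 0, (Projectivization.mk ℂ z hz).rep i ≠ 0 ↔ z i ≠ 0 := fun hz => by
    obtain ⟨a, ha⟩ := Projectivization.exists_smul_eq_mk_rep ℂ z hz
    rw [← ha, Pi.smul_apply, Units.smul_def, smul_eq_mul, mul_ne_zero_iff_left a.ne_zero]
  constructor
  · rintro ⟨hz, h'⟩
    exact (h hz).1 h'
  · intro hi
    exact ⟨fun h0 => hi (by simp [h0]), (h _).2 hi⟩

theorem affineCoord_mem_sections (i a : Fin (n + 1)) :
    (fun z : Coord n => z a / z i) ∈ sections n 0 (chart n i) := by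
  refine ⟨fun z hz => ?_, fun z hz t ht => ?_, fun z hz => ?_⟩
  · have h1 : DifferentiableAt ℂ (fun y : Coord n => y a) z := by fun_prop
    have h2 : DifferentiableAt ℂ (fun y : Coord n => y i) z := by fun_prop
    simpa only [div_eq_mul_inv] using
      (h1.fun_mul (h2.fun_inv (mem_cone_chart.1 hz))).differentiableWithinAt
  · simp [mul_div_mul_left _ _ ht]
  · have : z i = 0 := by simpa [mem_cone_chart] using hz
    simp [this]

/-- The Jacobi rule for the affine coordinates `Z_a / Z_i` says that the exterior product of the
trivector `hamDeriv L` with the Euler field vanishes. -/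
theorem mul_eval_hamDeriv {Λ : Coeffs n}
    {L : Fin (n + 1) → Fin (n + 1) → Poly n}
    (hL : ∀ a b z, z ≠ 0 → Λ a b z = eval z (L a b)) (hΛ : IsHolomorphicPoisson Λ)
    (i : Fin (n + 1)) {z : Coord n} (hi : z i ≠ 0)
    (hT : ∀ a b d, eval z (hamDeriv L a b d) = -eval z (hamDeriv L a d b)) (a b d : Fin (n + 1)) :
    z i * eval z (hamDeriv L a b d) = z a * eval z (hamDeriv L i b d)
      + z b * eval z (hamDeriv L a i d) + z d * eval z (hamDeriv L a b i) := by
  have hne : ∀ y : Coord n, y i ≠ 0 → y ≠ 0 := fun y hy h0 => hy (by simp [h0])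
  have hlsk : ∀ y : Coord n, y i ≠ 0 → ∀ a b, eval y (L a b) = -eval y (L b a) := by
    intro y hy a b
    rw [← hL _ _ y (hne y hy), ← hL _ _ y (hne y hy), hΛ.skew]
  have hTsk : ∀ a b d, eval z (hamDeriv L a b d) = -eval z (hamDeriv L b a d) := by
    intro a b d
    have hcoef : ∀ c, eval z (pderiv c (L a b)) = -eval z (pderiv c (L b a)) := by
      intro c
      rw [← partialZ_eq_eval (hL a b) c z (hne z hi), ← partialZ_eq_eval (hL b a) c z (hne z hi),
        show Λ a b = fun y => -Λ b a y from funext (hΛ.skew a b), partialZ, fderiv_fun_neg]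
      rfl
    simp only [hamDeriv, map_sum, map_mul, hcoef, mul_neg, Finset.sum_neg_distrib]
  set w : Fin (n + 1) → Coord n → ℂ := fun a z => z a / z i with hw
  -- The bracket of two affine coordinates is `M^{a,b} / Z_i ^ 3`.
  set M : Fin (n + 1) → Fin (n + 1) → Poly n :=
    fun a b => X i * L a b + X b * L i a + X a * L b i with hM
  have hpw : ∀ a c, ∀ y : Coord n, y i ≠ 0 → partialZ c (w a) y
      = (if a = c then 1 else 0) / y i - (if i = c then 1 else 0) * y a / y i ^ 2 := by
    intro a c y hy
    rw [partialZ_eq_of_eventuallyEq_div (F := X a) (m := 1) hy (fun x _ => by simp [hw]),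
      pderiv_X, Pi.single_apply]
    simp only [eq_comm (a := c)]
    split_ifs <;> simp
  have hbr : ∀ a b, ∀ y : Coord n, y i ≠ 0 →
      bracket Λ (w a) (w b) y = eval y (M a b) / y i ^ 3 := by
    intro a b y hy
    have hii : eval y (L i i) = 0 := self_eq_neg.1 (hlsk y hy i i)
    simp only [bracket, hpw _ _ y hy, hL _ _ y (hne y hy), hM, map_add, map_mul, eval_X]
    simp only [mul_sub, sub_mul, Finset.sum_sub_distrib, ite_mul, ite_div, mul_ite, one_mul,
      zero_mul, mul_zero, zero_div, Finset.sum_ite_eq, Finset.mem_univ, if_true]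
    rw [hii, hlsk y hy a i, hlsk y hy i b]
    field_simp
    ring
  set l : Fin (n + 1) → Fin (n + 1) → ℂ := fun a b => eval z (L a b) with hl
  set T : Fin (n + 1) → Fin (n + 1) → Fin (n + 1) → ℂ := fun a b d => eval z (hamDeriv L a b d)
    with hTdef
  have hsum : ∀ a b d, ∑ e, l d e * eval z (pderiv e (L a b)) = -T a b d := by
    intro a b d
    simp only [hTdef, hamDeriv, map_sum, map_mul, ← Finset.sum_neg_distrib]
    refine Finset.sum_congr rfl fun e _ => ?_
    rw [hlsk z hi e d]
    simp [hl]
  have hMe : ∀ a b d, ∑ e, l d e * eval z (pderiv e (M a b))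
      = l d i * l a b + l d b * l i a + l d a * l b i
        - z i * T a b d - z b * T i a d - z a * T b i d := by
    intro a b d
    have : ∀ e, l d e * eval z (pderiv e (M a b))
        = z i * (l d e * eval z (pderiv e (L a b))) + z b * (l d e * eval z (pderiv e (L i a)))
          + z a * (l d e * eval z (pderiv e (L b i))) + ((if e = i then l d e * l a b else 0)
          + (if e = b then l d e * l i a else 0) + (if e = a then l d e * l b i else 0)) := by
      intro e
      simp only [hM, map_add, Derivation.leibniz, pderiv_X, smul_eq_mul, map_mul, eval_X,
        Pi.single_apply, eq_comm (b := e), hl]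
      split_ifs <;> simp <;> ring
    simp only [this, Finset.sum_add_distrib, ← Finset.mul_sum, hsum, Finset.sum_ite_eq',
      Finset.mem_univ, if_true]
    ring
  have hbr2 : ∀ a b d, bracket Λ (w d) (bracket Λ (w a) (w b)) z * z i ^ 6
      = z i * (z i * ∑ e, l d e * eval z (pderiv e (M a b))
          - z d * ∑ e, l i e * eval z (pderiv e (M a b)))
        - 3 * eval z (M a b) * (z i * l d i) := by
    intro a b d
    have hii : l i i = 0 := self_eq_neg.1 (hlsk z hi i i)
    have h1 : bracket Λ (w d) (bracket Λ (w a) (w b)) z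
        = ∑ e, (l d e / z i - l i e * z d / z i ^ 2) * (eval z (pderiv e (M a b)) / z i ^ 3
            - 3 * (if e = i then 1 else 0) * eval z (M a b) / z i ^ 4) := by
      rw [bracket, Finset.sum_comm]
      refine Finset.sum_congr rfl fun e _ => ?_
      rw [← Finset.sum_mul, partialZ_eq_of_eventuallyEq_div hi (hbr a b)]
      congr 1
      simp only [hpw _ _ z hi, hL _ _ z (hne z hi), mul_sub, Finset.sum_sub_distrib, ite_mul,
        ite_div, mul_ite, one_mul, zero_mul, mul_zero, zero_div, Finset.sum_ite_eq,
        Finset.mem_univ, if_true, hl]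
      ring
    have h2 : ∀ e, (l d e / z i - l i e * z d / z i ^ 2) * (eval z (pderiv e (M a b)) / z i ^ 3
            - 3 * (if e = i then 1 else 0) * eval z (M a b) / z i ^ 4)
        = (l d e * eval z (pderiv e (M a b))) / z i ^ 4
          - z d / z i ^ 5 * (l i e * eval z (pderiv e (M a b)))
          - (if e = i then 3 * eval z (M a b) / z i ^ 4 *
              (l d e / z i - l i e * z d / z i ^ 2) else 0) := by
      intro e
      split_ifs
      · field_simp
      · field_simp
        ring
    rw [h1, Finset.sum_congr rfl fun e _ => h2 e]
    simp only [Finset.sum_sub_distrib, ← Finset.mul_sum, ← Finset.sum_div, Finset.sum_ite_eq',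
      Finset.mem_univ, if_true, hii]
    field_simp
    ring
  have hopen : IsOpen (cone (chart n i)) := by
    have : cone (chart n i) = {y : Coord n | y i ≠ 0} := Set.ext fun y => mem_cone_chart
    rw [this]
    exact isOpen_ne.preimage (continuous_apply i)
  have hJ := hΛ.jacobi _ hopen _ (affineCoord_mem_sections i d) _ (affineCoord_mem_sections i a) _
    (affineCoord_mem_sections i b) z (mem_cone_chart.2 hi)
  have hJ' := congrArg (· * z i ^ 6) hJ
  simp only [add_mul, zero_mul] at hJ'
  have e1 := hbr2 a b d
  have e2 := hbr2 b d a
  have e3 := hbr2 d a b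
  simp only [hw] at e1 e2 e3
  rw [e1, e2, e3] at hJ'
  simp only [hMe] at hJ'
  have s12 : ∀ a b d, T a b d = -T b a d := hTsk
  have s23 : ∀ a b d, T a b d = -T a d b := hT
  have T0 : ∀ a b, T a b b = 0 := fun a b => self_eq_neg.1 (s23 a b b)
  have T0' : ∀ a b, T a b a = 0 := fun a b => by rw [s12, T0, neg_zero]
  have hM' : ∀ a b, eval z (M a b) = z i * l a b + z b * l i a + z a * l b i := fun a b => by
    simp [hM, hl]
  have hlz : ∀ a b, l a b = -l b a := hlsk z hi
  have l1 := hlz d i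
  have l2 := hlz a i
  have l3 := hlz b i
  have l4 := hlz b a
  have l5 := hlz d b
  have l6 := hlz a d
  have t1 : T i a d = -T a i d := s12 _ _ _
  have t2 : T b i d = -T i b d := s12 _ _ _
  have t3 : T b d a = T a b d := by rw [s23, s12 b a d, neg_neg]
  have t4 : T d i b = T i b d := by rw [s12, s23, neg_neg]
  have t5 : T b d i = T i b d := by rw [s23, s12, neg_neg]
  have t6 : T d a b = T a b d := by rw [s12, s23, neg_neg]
  have t7 : T i d b = -T i b d := s23 _ _ _
  have t8 : T a i b = -T a b i := s23 _ _ _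
  have t9 : T d a i = T a i d := by rw [s12, s23, neg_neg]
  have t10 : T i b a = -T a b i := by rw [s12, s23, s12 b a i, neg_neg]
  have t11 : T d i a = -T a i d := by rw [s12, s23, s12 i a d, neg_neg]
  have lii : l i i = 0 := self_eq_neg.1 (hlz i i)
  simp only [hM', T0, T0', lii] at hJ'
  simp only [t1, t2, t3, t5, t6, t7, t8, t9, t10, t11, l1, l2, l3, l4, l5, l6] at hJ'
  have h3 : (3 * z i ^ 2 : ℂ) ≠ 0 := by simp [hi]
  apply mul_left_cancel₀ h3
  linear_combination -hJ'

/-- Linear algebra at a point `z`: `l` stands for the values of the coefficients and `δ c` for their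
partial derivatives, so that `T` is the trivector `hamDeriv`. It vanishes if its exterior product
with the Euler field does, since the coefficients have the nonzero degree two. -/
theorem trivector_eq_zero {ι : Type*} [Fintype ι] {z : ι → ℂ} {l : ι → ι → ℂ} {δ : ι → ι → ι → ℂ}
    {T : ι → ι → ι → ℂ} (hT : ∀ a b d, T a b d = ∑ c, l c d * δ c a b)
    (hl : ∀ a b, l a b = -l b a) (hδ : ∀ c a b, δ c a b = -δ c b a)
    (euler : ∀ a b, ∑ c, z c * δ c a b = 2 * l a b) (hsk : ∀ a b d, T a b d = -T a d b)
    {i : ι} (hi : z i ≠ 0)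
    (hJ : ∀ a b d, z i * T a b d = z a * T i b d + z b * T a i d + z d * T a b i) (a b d : ι) :
    T a b d = 0 := by
  have s12 : ∀ a b d, T a b d = -T b a d := fun a b d => by
    simp only [hT, hδ _ a b, mul_neg, Finset.sum_neg_distrib]
  -- The contraction `∑ T^{d,e,f} δ_f l^{a,b}` equals the bracket of the coefficients `l^{d,e}` and
  -- `l^{a,b}`, and is therefore skew under the exchange of the two pairs.
  set Q : ι → ι → ι → ι → ℂ := fun d e a b => ∑ f, T d e f * δ f a b with hQ
  have swap : ∀ d e a b, Q d e a b = -Q a b d e := by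
    intro d e a b
    simp only [hQ, hT, Finset.sum_mul]
    rw [Finset.sum_comm, ← Finset.sum_neg_distrib]
    refine Finset.sum_congr rfl fun c _ => ?_
    rw [← Finset.sum_neg_distrib]
    refine Finset.sum_congr rfl fun f _ => ?_
    rw [hl c f]
    ring
  have contr : ∀ d e a b, z i * Q d e a b
      = z d * Q i e a b + z e * Q d i a b + 2 * T d e i * l a b := by
    intro d e a b
    have : 2 * T d e i * l a b = ∑ f, T d e i * (z f * δ f a b) := by
      rw [← Finset.mul_sum, euler]
      ring
    rw [this]
    simp only [hQ, Finset.mul_sum, ← Finset.sum_add_distrib]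
    refine Finset.sum_congr rfl fun f _ => ?_
    linear_combination δ f a b * hJ d e f
  -- The tensor `m` is the restriction of `l` to the annihilator of the Euler field.
  set m : ι → ι → ℂ := fun a b => z i * l a b - z a * l i b - z b * l a i with hm
  have key : ∀ d e a b, T d e i * m a b + T a b i * m d e = 0 := by
    intro d e a b
    have h2 : (2 : ℂ) ≠ 0 := two_ne_zero
    apply mul_left_cancel₀ h2
    simp only [hm]
    linear_combination (-z i) * contr d e a b + z a * contr d e i b + z b * contr d e a i
      - z i * contr a b d e + z d * contr a b i e + z e * contr a b d i
      + z i * z i * swap d e a b - z i * z d * swap i e a b - z i * z e * swap d i a b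
      - z a * z i * swap d e i b + z a * z d * swap i e i b + z a * z e * swap d i i b
      - z b * z i * swap d e a i + z b * z d * swap i e a i + z b * z e * swap d i a i
  -- As `T` is the exterior product of the Euler field with a bivector, it suffices that the
  -- components `T^{a,b,i}`, which determine this bivector, vanish.
  have hS : ∀ a b, T a b i = 0 := by
    by_cases h : ∃ a b, m a b ≠ 0
    · -- The diagonal case of `key` gives `T^{a,b,i} = 0` where `m^{a,b} ≠ 0`.
      obtain ⟨a, b, hab⟩ := h
      have h0 : T a b i = 0 := by
        have := key a b a b
        rw [← two_mul, mul_eq_zero] at this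
        exact (mul_eq_zero.1 (this.resolve_left two_ne_zero)).resolve_right hab
      intro d e
      have := key d e a b
      rw [h0, zero_mul, add_zero] at this
      exact (mul_eq_zero.1 this).resolve_right hab
    · -- If `m = 0`, then `T^{a,b,i}` is both symmetric and skew in `a, b`.
      push Not at h
      have h1 : ∀ a b, z i * T a b i = 2 * l i a * l i b := by
        intro a b
        have e1 : T a b i = T i a b := by rw [hsk, s12, neg_neg]
        have e2 : T i a i = 0 := by
          rw [s12, self_eq_neg.1 (hsk a i i), neg_zero]
        have e3 : ∀ c, z i * (l c b * δ c i a)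
            = l i b * (z c * δ c i a) + z b * (l c i * δ c i a) := by
          intro c
          have := h c b
          simp only [hm] at this
          linear_combination δ c i a * this
        rw [e1, hT, Finset.mul_sum, Finset.sum_congr rfl fun c _ => e3 c, Finset.sum_add_distrib,
          ← Finset.mul_sum, ← Finset.mul_sum, euler, ← hT, e2]
        ring
      intro a b
      have h2 : z i * T a b i = -(z i * T a b i) := by
        have h3 := h1 b a
        rw [s12 b a i] at h3
        linear_combination h1 a b - h3
      exact (mul_eq_zero.1 (self_eq_neg.1 h2)).resolve_left hi
  have := hJ a b d
  rw [hS a b, s12 i b d, hsk b i d, hS, hsk a i d, hS] at this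
  simpa [hi] using this

/-! ### The coefficients are annihilated by the Hamiltonian vector fields -/

theorem eq_zero_of_eval_eq_zero {F : Poly n}
    (h : ∀ z : Coord n, z ≠ 0 → eval z F = 0) : F = 0 := by
  -- Multiplication by `Z_0` takes care of the value at the origin.
  have h1 : X 0 * F = 0 := MvPolynomial.funext fun z => by
    by_cases hz : z = 0
    · simp [hz]
    · simp [h z hz]
  exact (mul_eq_zero.1 h1).resolve_left (X_ne_zero 0)

theorem eq_of_eval_eq {F G : Poly n}
    (h : ∀ z : Coord n, z ≠ 0 → eval z F = eval z G) : F = G :=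
  sub_eq_zero.1 (eq_zero_of_eval_eq_zero fun z hz => by rw [map_sub, h z hz, sub_self])

/-- The Hamiltonian vector fields `{·, Z_d}` of the homogeneous coordinates annihilate the coefficients
`Λ^{a,b}`. This is stronger than the Jacobi rule for all functions of the homogeneous coordinates. -/
theorem hamDeriv_eq_zero {Λ : Coeffs n}
    {L : Fin (n + 1) → Fin (n + 1) → Poly n}
    (hLhom : ∀ a b, (L a b).IsHomogeneous 2)
    (hL : ∀ a b z, z ≠ 0 → Λ a b z = eval z (L a b)) (hΛ : IsHolomorphicPoisson Λ)
    (hrel : OrderedRelation Λ) (a b d : Fin (n + 1)) : hamDeriv L a b d = 0 := by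
  have hskew : ∀ a b, L a b = -L b a := fun a b => eq_of_eval_eq fun z hz => by
    rw [map_neg, ← hL _ _ z hz, ← hL _ _ z hz, hΛ.skew]
  refine eq_zero_of_eval_eq_zero fun z hz => ?_
  obtain ⟨i, hi⟩ := Function.ne_iff.1 hz
  have hT := fun a b d => eval_hamDeriv_skew hL hrel a b d z hz
  refine trivector_eq_zero (z := z) (l := fun a b => eval z (L a b))
    (δ := fun c a b => eval z (pderiv c (L a b))) (T := fun a b d => eval z (hamDeriv L a b d))
    (fun a b d => by simp [hamDeriv]) (fun a b => by rw [hskew, map_neg])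
    (fun c a b => by rw [hskew, map_neg, map_neg]) (fun a b => ?_) hT hi
    (mul_eval_hamDeriv hL hΛ i hi hT) a b d
  have := congrArg (eval z) (hLhom a b).sum_X_mul_pderiv
  simpa using this

end

section

open Filter Topology MvPolynomial

variable {n : ℕ}

/-! ### Global sections as homogeneous polynomials -/

theorem exists_mvPolynomial_of_mem_H0 {k : ℕ} (f : H0 n k) :
    ∃ F : Poly n, F.IsHomogeneous k ∧ ∀ z, z ≠ 0 → f.1 z = eval z F :=
  (isPuncturedHomogeneous_of_mem_H0 f.2).exists_mvPolynomial

/-- The homogeneous polynomial that a section of `O(k)` is given by off the origin. -/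
def toPoly (n k : ℕ) : H0 n k →ₗ[ℂ] Poly n where
  toFun f := (exists_mvPolynomial_of_mem_H0 f).choose
  map_add' f g := eq_of_eval_eq fun z hz => by
    rw [map_add, ← (exists_mvPolynomial_of_mem_H0 _).choose_spec.2 z hz,
      ← (exists_mvPolynomial_of_mem_H0 f).choose_spec.2 z hz,
      ← (exists_mvPolynomial_of_mem_H0 g).choose_spec.2 z hz]
    rfl
  map_smul' c f := eq_of_eval_eq fun z hz => by
    rw [smul_eval, ← (exists_mvPolynomial_of_mem_H0 _).choose_spec.2 z hz, RingHom.id_apply,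
      ← (exists_mvPolynomial_of_mem_H0 f).choose_spec.2 z hz]
    rfl

theorem toPoly_isHomogeneous {k : ℕ} (f : H0 n k) : (toPoly n k f).IsHomogeneous k :=
  (exists_mvPolynomial_of_mem_H0 f).choose_spec.1

theorem eval_toPoly {k : ℕ} (f : H0 n k) {z : Coord n} (hz : z ≠ 0) :
    eval z (toPoly n k f) = f.1 z :=
  ((exists_mvPolynomial_of_mem_H0 f).choose_spec.2 z hz).symm

theorem section_zero {k : ℤ} (f : H0 n k) : f.1 0 = 0 :=
  f.2.2.2 0 (by simp [mem_cone_univ])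

theorem toPoly_injective (n k : ℕ) : Function.Injective (toPoly n k) := by
  intro f g h
  refine Subtype.ext (funext fun z => ?_)
  by_cases hz : z = 0
  · rw [hz, section_zero, section_zero]
  · rw [← eval_toPoly f hz, ← eval_toPoly g hz, h]

theorem toPoly_eq {k : ℕ} {f : H0 n k} {F : Poly n}
    (h : ∀ z, z ≠ 0 → f.1 z = eval z F) : toPoly n k f = F :=
  eq_of_eval_eq fun z hz => by rw [eval_toPoly f hz, h z hz]

theorem toPoly_oneSection : toPoly n 0 (oneSection n) = 1 :=
  toPoly_eq fun z hz => by simp [oneSection, hz]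

theorem eval_smul_of_isHomogeneous {k : ℕ} {F : Poly n}
    (hF : F.IsHomogeneous k) (t : ℂ) (z : Coord n) : eval (t • z) F = t ^ k * eval z F := by
  rw [eval_eq', eval_eq', Finset.mul_sum]
  refine Finset.sum_congr rfl fun d hd => ?_
  have h : ∑ i, d i = k := by
    rw [← hF (mem_support_iff.1 hd), Finsupp.weight_apply, Finsupp.sum_fintype _ _ (by simp)]
    simp
  simp only [Pi.smul_apply, smul_eq_mul, mul_pow, Finset.prod_mul_distrib,
    Finset.prod_pow_eq_pow_sum, h]
  ring

/-- The section of `O(k)` defined by the homogeneous component of degree `k` of a polynomial. -/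
def ofPoly (n k : ℕ) : Poly n →ₗ[ℂ] H0 n k where
  toFun F := ⟨fun z => if z = 0 then 0 else eval z (homogeneousComponent k F), by
    refine ⟨fun z hz => ?_, fun z hz t ht => ?_, fun z hz => ?_⟩
    · refine DifferentiableAt.differentiableWithinAt ?_
      have hd := (hasFDerivAt_eval (homogeneousComponent k F) z).differentiableAt
      refine hd.congr_of_eventuallyEq ?_
      filter_upwards [isOpen_ne.mem_nhds (mem_cone_univ.1 hz)] with y hy using if_neg hy
    · have h0 := mem_cone_univ.1 hz
      have h1 := homogeneousComponent_isHomogeneous k F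
      simp only [smul_ne_zero ht h0, h0, if_false, zpow_natCast]
      exact eval_smul_of_isHomogeneous h1 t z
    · have : z = 0 := by simpa [mem_cone_univ] using hz
      simp [this]⟩
  map_add' F G := Subtype.ext <| funext fun z => by
    by_cases hz : z = 0 <;> simp [hz]
  map_smul' c F := Subtype.ext <| funext fun z => by
    by_cases hz : z = 0 <;> simp [hz, smul_eval]

theorem toPoly_ofPoly {k : ℕ} {F : Poly n} (hF : F.IsHomogeneous k) :
    toPoly n k (ofPoly n k F) = F :=
  toPoly_eq fun z hz => by
    simp [ofPoly, hz, homogeneousComponent_eq_self hF]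

/-! ### The operators of the star product -/

/-- The coefficient of `μ ^ p` in the star product of two polynomials. -/
def starCoeff (L : Fin (n + 1) → Fin (n + 1) → Poly n) (p : ℕ) :
    Poly n →ₗ[ℂ] Poly n →ₗ[ℂ]
      Poly n :=
  ((1 / (p.factorial : ℂ)) * (1 / 2) ^ p) • bidiffPower (fun a => pderiv a) L p

variable {L : Fin (n + 1) → Fin (n + 1) → Poly n}

theorem pderiv_eq_zero_of_isHomogeneous_zero {F : Poly n}
    (hF : F.IsHomogeneous 0) (a : Fin (n + 1)) : pderiv a F = 0 := by
  obtain ⟨c, rfl⟩ : ∃ c, F = C c :=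
    ⟨_, totalDegree_eq_zero_iff_eq_C.1 (Nat.le_zero.1 hF.totalDegree_le)⟩
  exact pderiv_C

theorem bidiffPower_eq_zero_of_lt {k p : ℕ} {F : Poly n}
    (hF : F.IsHomogeneous k) (hp : k < p) (G : Poly n) :
    bidiffPower (fun a => pderiv a) L p F G = 0 := by
  induction p generalizing k F G with
  | zero => omega
  | succ p ih =>
    rw [bidiffPower_succ]
    refine Finset.sum_eq_zero fun a _ => Finset.sum_eq_zero fun b _ => ?_
    rcases Nat.eq_zero_or_pos k with rfl | hk
    · simp [pderiv_eq_zero_of_isHomogeneous_zero hF]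
    · rw [ih (hF.pderiv (i := a)) (by omega), mul_zero]

theorem bidiffPower_isHomogeneous (hLhom : ∀ a b, (L a b).IsHomogeneous 2) {k l : ℕ} (p : ℕ)
    {F G : Poly n} (hF : F.IsHomogeneous k) (hG : G.IsHomogeneous l) :
    (bidiffPower (fun a => pderiv a) L p F G).IsHomogeneous (k + l) := by
  induction p generalizing k l F G with
  | zero => exact hF.mul hG
  | succ p ih =>
    rw [bidiffPower_succ]
    refine IsHomogeneous.sum _ _ _ fun a _ => IsHomogeneous.sum _ _ _ fun b _ => ?_
    rcases Nat.eq_zero_or_pos k with rfl | hk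
    · rw [pderiv_eq_zero_of_isHomogeneous_zero hF, map_zero, LinearMap.zero_apply, mul_zero]
      exact isHomogeneous_zero _ _ _
    rcases Nat.eq_zero_or_pos l with rfl | hl
    · rw [pderiv_eq_zero_of_isHomogeneous_zero hG, map_zero, mul_zero]
      exact isHomogeneous_zero _ _ _
    have := (hLhom a b).mul (ih (hF.pderiv (i := a)) (hG.pderiv (i := b)))
    rwa [show 2 + (k - 1 + (l - 1)) = k + l by omega] at this

theorem starCoeff_apply (p : ℕ) (F G : Poly n) :
    starCoeff L p F G = ((1 / (p.factorial : ℂ)) * (1 / 2) ^ p) •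
      bidiffPower (fun a => pderiv a) L p F G := rfl

theorem starCoeff_eq_zero_of_lt {k p : ℕ} {F : Poly n}
    (hF : F.IsHomogeneous k) (hp : k < p) (G : Poly n) :
    starCoeff L p F G = 0 := by
  rw [starCoeff_apply, bidiffPower_eq_zero_of_lt hF hp, smul_zero]

theorem starCoeff_isHomogeneous (hLhom : ∀ a b, (L a b).IsHomogeneous 2) {k l : ℕ} (p : ℕ)
    {F G : Poly n} (hF : F.IsHomogeneous k) (hG : G.IsHomogeneous l) :
    (starCoeff L p F G).IsHomogeneous (k + l) := by
  rw [starCoeff_apply, smul_eq_C_mul]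
  exact (bidiffPower_isHomogeneous hLhom p hF hG).C_mul _

@[simp]
theorem starCoeff_zero (F G : Poly n) : starCoeff L 0 F G = F * G := by
  simp [starCoeff_apply]

theorem starCoeff_one_left (p : ℕ) (F : Poly n) :
    starCoeff L p 1 F = if p = 0 then F else 0 := by
  rw [starCoeff_apply, bidiffPower_one_left]
  split_ifs with h <;> simp [h]

theorem starCoeff_one_right (p : ℕ) (F : Poly n) :
    starCoeff L p F 1 = if p = 0 then F else 0 := by
  rw [starCoeff_apply, bidiffPower_one_right]
  split_ifs with h <;> simp [h]

theorem starCoeff_one_X_X (a b : Fin (n + 1)) :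
    starCoeff L 1 (X a) (X b) = (1 / 2 : ℂ) • L a b := by
  rw [starCoeff_apply, bidiffPower_succ]
  simp [pderiv_X, Pi.single_apply]

theorem pderiv_pderiv_comm (a b : Fin (n + 1)) (F : Poly n) :
    pderiv a (pderiv b F) = pderiv b (pderiv a F) := by
  have h : ⁅pderiv (R := ℂ) a, pderiv b⁆ = 0 := derivation_ext fun i => by
    rw [Derivation.commutator_apply, pderiv_X, pderiv_X, Pi.single_apply, Pi.single_apply]
    split_ifs <;> simp
  have := congrArg (fun D => D F) h
  simpa [Derivation.commutator_apply, sub_eq_zero] using this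

/-- Associativity of the star product of polynomials in each power of the formal parameter. -/
theorem sum_starCoeff_assoc (hskew : ∀ a b, L a b = -L b a) (hT : ∀ a b d, hamDeriv L a b d = 0)
    (N : ℕ) (F G H : Poly n) :
    ∑ p ∈ Finset.HasAntidiagonal.antidiagonal N, starCoeff L p.2 (starCoeff L p.1 F G) H
      = ∑ p ∈ Finset.HasAntidiagonal.antidiagonal N, starCoeff L p.1 F (starCoeff L p.2 G H) := by
  have h := sum_choose_bidiffPower_assoc (D := fun a => pderiv (R := ℂ) a) (L := L)
    (fun a b d => hT a b d) pderiv_pderiv_comm hskew N F G H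
  have hc : ∀ p ∈ Finset.HasAntidiagonal.antidiagonal N, ∀ x : Poly n,
      ((1 / (p.2.factorial : ℂ)) * (1 / 2) ^ p.2) • ((1 / (p.1.factorial : ℂ)) * (1 / 2) ^ p.1) • x
        = ((1 / (N.factorial : ℂ)) * (1 / 2) ^ N) • ((N.choose p.1 : Poly n) * x) := by
    intro p hp x
    obtain rfl := Finset.HasAntidiagonal.mem_antidiagonal.1 hp
    have h1 : ((p.1 + p.2).choose p.1 : Poly n) * x
        = ((p.1 + p.2).choose p.1 : ℂ) • x := by
      rw [smul_eq_C_mul, map_natCast]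
    rw [h1, smul_smul, smul_smul, Nat.cast_add_choose]
    congr 1
    have := Nat.cast_ne_zero (R := ℂ).2 (p.1.factorial_ne_zero)
    have := Nat.cast_ne_zero (R := ℂ).2 (p.2.factorial_ne_zero)
    have := Nat.cast_ne_zero (R := ℂ).2 ((p.1 + p.2).factorial_ne_zero)
    field_simp
    ring
  calc _ = ((1 / (N.factorial : ℂ)) * (1 / 2) ^ N) • ∑ p ∈ Finset.HasAntidiagonal.antidiagonal N,
        (N.choose p.1 : Poly n) * bidiffPower (fun a => pderiv a) L p.2
          (bidiffPower (fun a => pderiv a) L p.1 F G) H := by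
        rw [Finset.smul_sum]
        refine Finset.sum_congr rfl fun p hp => ?_
        rw [← hc p hp, starCoeff_apply, starCoeff_apply, map_smul, LinearMap.smul_apply]
    _ = _ := by
        rw [h, Finset.smul_sum]
        refine Finset.sum_congr rfl fun p hp => ?_
        rw [← hc p hp, starCoeff_apply, starCoeff_apply, map_smul, smul_comm]

/-- On sections, the operator `B_p` is given off the origin by a polynomial, and vanishes there. -/
theorem symbolPower_sections {Λ : Coeffs n} (hΛ : IsHolomorphicPoisson Λ)
    (hL : ∀ a b z, z ≠ 0 → Λ a b z = eval z (L a b)) {k l : ℕ} (f : H0 n k) (g : H0 n l) (p : ℕ) :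
    symbolPower Λ p f.1 g.1 = fun z => if z = 0 then 0 else
      eval z (bidiffPower (fun a => pderiv a) L p (toPoly n k f) (toPoly n l g)) := by
  funext z
  split_ifs with hz
  · subst hz
    cases p with
    | zero => simp [symbolPower, partials, section_zero f]
    | succ p =>
      rw [symbolPower_succ]
      refine Finset.sum_eq_zero fun a _ => Finset.sum_eq_zero fun b _ => ?_
      have : Λ a b 0 = 0 := section_zero ⟨Λ a b, hΛ.holomorphic a b⟩
      rw [this, zero_mul]
  · exact symbolPower_eq_eval hL p (fun z hz => (eval_toPoly f hz).symm)
      (fun z hz => (eval_toPoly g hz).symm) z hz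

theorem symbolPower_eq_zero_iff {Λ : Coeffs n} (hΛ : IsHolomorphicPoisson Λ)
    (hL : ∀ a b z, z ≠ 0 → Λ a b z = eval z (L a b)) {k l : ℕ} (f : H0 n k) (g : H0 n l) (p : ℕ) :
    symbolPower Λ p f.1 g.1 = 0 ↔ starCoeff L p (toPoly n k f) (toPoly n l g) = 0 := by
  rw [symbolPower_sections hΛ hL, starCoeff_apply, smul_eq_zero_iff_right]
  · constructor
    · intro h
      refine eq_zero_of_eval_eq_zero fun z hz => ?_
      simpa [hz] using congrFun h z
    · intro h
      simp only [h, map_zero, ite_self]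
      rfl
  · exact mul_ne_zero (one_div_ne_zero (Nat.cast_ne_zero.2 p.factorial_ne_zero))
      (pow_ne_zero _ (by norm_num))

end

section

open MvPolynomial

/-! ### Bilinear products on direct sums -/

section GradedProduct

variable {V : ℕ → Type*} [∀ k, AddCommMonoid (V k)] [∀ k, Module ℂ (V k)]

/-- The bilinear product on `⨁ V k` with the homogeneous parts `β k l : V k × V l → V (k + l)`. -/
def gradedProduct (β : ∀ k l, V k →ₗ[ℂ] V l →ₗ[ℂ] V (k + l)) :
    (⨁ k, V k) →ₗ[ℂ] (⨁ k, V k) →ₗ[ℂ] ⨁ k, V k :=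
  DirectSum.toModule ℂ ℕ _ fun k => LinearMap.flip <| DirectSum.toModule ℂ ℕ _ fun l =>
    LinearMap.flip <| (β k l).compr₂ (DirectSum.lof ℂ ℕ V (k + l))

variable {β : ∀ k l, V k →ₗ[ℂ] V l →ₗ[ℂ] V (k + l)}

theorem gradedProduct_lof_lof {k l : ℕ} (x : V k) (y : V l) :
    gradedProduct β (DirectSum.lof ℂ ℕ V k x) (DirectSum.lof ℂ ℕ V l y)
      = DirectSum.lof ℂ ℕ V (k + l) (β k l x y) := by
  simp [gradedProduct]

/-- Homogeneous elements whose degrees are equal, but not by definition, are compared in a common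
space `X`. -/
theorem lof_eq_lof {X : Type*} {ρ : ∀ k, V k → X} (hρ : ∀ k, Function.Injective (ρ k)) {k l : ℕ}
    (h : k = l) {x : V k} {y : V l} (hxy : ρ k x = ρ l y) :
    DirectSum.lof ℂ ℕ V k x = DirectSum.lof ℂ ℕ V l y := by
  subst h
  rw [hρ k hxy]

/-- Bilinear maps on a direct sum agree if they agree on homogeneous elements. -/
theorem bilinear_ext {W : Type*} [AddCommMonoid W] [Module ℂ W]
    {P Q : (⨁ k, V k) →ₗ[ℂ] (⨁ k, V k) →ₗ[ℂ] W}
    (h : ∀ k l (x : V k) (y : V l),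
      P (DirectSum.lof ℂ ℕ V k x) (DirectSum.lof ℂ ℕ V l y)
        = Q (DirectSum.lof ℂ ℕ V k x) (DirectSum.lof ℂ ℕ V l y)) : P = Q :=
  DirectSum.linearMap_ext ℂ fun k => LinearMap.ext fun x =>
    DirectSum.linearMap_ext ℂ fun l => LinearMap.ext fun y => h k l x y

variable {X : Type*} {ρ : ∀ k, V k → X} (hρ : ∀ k, Function.Injective (ρ k))
include hρ

theorem gradedProduct_assoc
    (h : ∀ k l m (x : V k) (y : V l) (z : V m),
      ρ _ (β (k + l) m (β k l x y) z) = ρ _ (β k (l + m) x (β l m y z))) (F G H : ⨁ k, V k) :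
    gradedProduct β (gradedProduct β F G) H = gradedProduct β F (gradedProduct β G H) := by
  induction H using DirectSum.induction_on with
  | zero => simp
  | add H H' hH hH' => simp only [map_add, hH, hH']
  | of m z =>
    rw [← DirectSum.lof_eq_of ℂ]
    have : (gradedProduct β).compr₂ ((gradedProduct β).flip (DirectSum.lof ℂ ℕ V m z))
        = (gradedProduct β).compl₂ ((gradedProduct β).flip (DirectSum.lof ℂ ℕ V m z)) := by
      refine bilinear_ext fun k l x y => ?_
      simp only [LinearMap.compr₂_apply, LinearMap.compl₂_apply, LinearMap.flip_apply,
        gradedProduct_lof_lof]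
      exact lof_eq_lof hρ (add_assoc k l m) (h k l m x y z)
    exact congrArg (fun P => P F G) this

theorem gradedProduct_one {e : V 0}
    (hl : ∀ k (x : V k), ρ _ (β 0 k e x) = ρ k x) (hr : ∀ k (x : V k), ρ _ (β k 0 x e) = ρ k x)
    (F : ⨁ k, V k) :
    gradedProduct β (DirectSum.lof ℂ ℕ V 0 e) F = F ∧
      gradedProduct β F (DirectSum.lof ℂ ℕ V 0 e) = F := by
  induction F using DirectSum.induction_on with
  | zero => simp
  | add F F' hF hF' => simp only [map_add, LinearMap.add_apply, hF, hF', and_self]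
  | of k x =>
    rw [← DirectSum.lof_eq_of ℂ, gradedProduct_lof_lof, gradedProduct_lof_lof]
    exact ⟨lof_eq_lof hρ (zero_add k) (hl k x), lof_eq_lof hρ (add_zero k) (hr k x)⟩

end GradedProduct

/-! ### Finiteness of convolutions -/

/-- For each of the kinds of formal series, the products of three series are defined, since only
finitely many terms contribute to each power of the parameter. -/
theorem FormalKind.Admissible.finite_convolution {κ : FormalKind} {S T U : Set ℤ}
    (hS : κ.Admissible S) (hT : κ.Admissible T) (hU : κ.Admissible U) (m : ℤ) :
    {t : ℤ × ℤ | t.1 ∈ S ∧ t.2 ∈ T ∧ m - t.1 - t.2 ∈ U}.Finite := by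
  have below : BddBelow S → BddBelow T → BddBelow U →
      {t : ℤ × ℤ | t.1 ∈ S ∧ t.2 ∈ T ∧ m - t.1 - t.2 ∈ U}.Finite := by
    rintro ⟨a, ha⟩ ⟨b, hb⟩ ⟨c, hc⟩
    refine ((Set.finite_Icc a (m - b - c)).prod (Set.finite_Icc b (m - a - c))).subset ?_
    rintro ⟨i, j⟩ ⟨hi, hj, hij⟩
    have h1 := ha hi
    have h2 := hb hj
    have h3 := hc hij
    simp only [Set.mem_prod, Set.mem_Icc] at *
    omega
  cases κ with
  | powerSeries =>
    exact below ⟨0, fun x hx => hS hx⟩ ⟨0, fun x hx => hT hx⟩ ⟨0, fun x hx => hU hx⟩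
  | laurentPolynomial =>
    exact (Set.Finite.prod hS hT).subset fun t ht => ⟨ht.1, ht.2.1⟩
  | laurentSeries => exact below hS hT hU
  | inverseLaurentSeries =>
    obtain ⟨a, ha⟩ := hS
    obtain ⟨b, hb⟩ := hT
    obtain ⟨c, hc⟩ := hU
    refine ((Set.finite_Icc (m - b - c) a).prod (Set.finite_Icc (m - a - c) b)).subset ?_
    rintro ⟨i, j⟩ ⟨hi, hj, hij⟩
    have h1 := ha hi
    have h2 := hb hj
    have h3 := hc hij
    simp only [Set.mem_prod, Set.mem_Icc] at *
    omega

/-- The exponents that occur in a product whose terms raise the exponent by at most `k`. The bound is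
needed for the series with finitely many positive powers. -/
theorem FormalKind.Admissible.shifted_add {κ : FormalKind} {S T : Set ℤ}
    (hS : κ.Admissible S) (hT : κ.Admissible T) (k : ℕ) :
    κ.Admissible {m | ∃ p : ℕ, p ≤ k ∧ ∃ i ∈ S, m - p - i ∈ T} := by
  cases κ with
  | powerSeries =>
    rintro m ⟨p, -, i, hi, hm⟩
    have h1 := hS hi
    have h2 := hT hm
    simp only [Set.mem_Ici] at *
    omega
  | laurentPolynomial =>
    refine (((Set.finite_Iic k).prod (Set.Finite.prod hS hT)).image
      fun t => (t.1 : ℤ) + t.2.1 + t.2.2).subset ?_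
    rintro m ⟨p, hp, i, hi, hm⟩
    exact ⟨(p, i, m - p - i), ⟨hp, hi, hm⟩, by simp⟩
  | laurentSeries =>
    obtain ⟨a, ha⟩ := hS
    obtain ⟨b, hb⟩ := hT
    refine ⟨a + b, ?_⟩
    rintro m ⟨p, -, i, hi, hm⟩
    have h1 := ha hi
    have h2 := hb hm
    omega
  | inverseLaurentSeries =>
    obtain ⟨a, ha⟩ := hS
    obtain ⟨b, hb⟩ := hT
    refine ⟨k + a + b, ?_⟩
    rintro m ⟨p, hp, i, hi, hm⟩
    have h1 := ha hi
    have h2 := hb hm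
    omega

/-- A finite sum over `ℕ × ℕ` is determined by the sums over the antidiagonals. -/
theorem finsum_eq_finsum_of_antidiagonal {M : Type*} [AddCommMonoid M] {φ ψ : ℕ × ℕ → M}
    (hφ : φ.support.Finite) (hψ : ψ.support.Finite)
    (h : ∀ N, ∑ p ∈ Finset.HasAntidiagonal.antidiagonal N, φ p
      = ∑ p ∈ Finset.HasAntidiagonal.antidiagonal N, ψ p) : ∑ᶠ p, φ p = ∑ᶠ p, ψ p := by
  obtain ⟨K, hK⟩ := ((hφ.union hψ).image fun p => p.1 + p.2).bddAbove
  have hsub : φ.support ∪ ψ.support ⊆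
      ((Finset.range (K + 1)).biUnion Finset.HasAntidiagonal.antidiagonal : Finset (ℕ × ℕ)) := by
    intro p hp
    have : p.1 + p.2 ≤ K := hK ⟨p, hp, rfl⟩
    simp only [Finset.coe_biUnion, Set.mem_iUnion, Finset.mem_coe, Finset.mem_range,
      Finset.HasAntidiagonal.mem_antidiagonal]
    exact ⟨p.1 + p.2, by omega, rfl⟩
  have hdisj : Set.PairwiseDisjoint (Finset.range (K + 1) : Set ℕ)
      (Finset.HasAntidiagonal.antidiagonal (A := ℕ)) := by
    intro i _ j _ hij
    refine Finset.disjoint_left.2 fun p hp hq => hij ?_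
    rw [← Finset.HasAntidiagonal.mem_antidiagonal.1 hp,
      ← Finset.HasAntidiagonal.mem_antidiagonal.1 hq]
  rw [finsum_eq_sum_of_support_subset _ (Set.subset_union_left.trans hsub),
    finsum_eq_sum_of_support_subset _ (Set.subset_union_right.trans hsub),
    Finset.sum_biUnion hdisj, Finset.sum_biUnion hdisj]
  exact Finset.sum_congr rfl fun N _ => h N

end

section

open MvPolynomial
open Function (support)

variable {n : ℕ} {L : Fin (n + 1) → Fin (n + 1) → Poly n}

/-! ### The star products of polynomials and of formal series of polynomials -/

theorem linearMap_finsum {M N α : Type*} [AddCommGroup M] [Module ℂ M] [AddCommGroup N] [Module ℂ N]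
    (A : M →ₗ[ℂ] N) {φ : α → M} (h : φ.support.Finite) : A (∑ᶠ i, φ i) = ∑ᶠ i, A (φ i) :=
  A.toAddMonoidHom.map_finsum h

theorem finsum_isHomogeneous {α : Type*} {φ : α → Poly n} {k : ℕ}
    (h : ∀ i, (φ i).IsHomogeneous k) : (∑ᶠ i, φ i).IsHomogeneous k :=
  finsum_induction (fun F : Poly n => F.IsHomogeneous k) (isHomogeneous_zero _ _ _)
    (fun _ _ => .add) h

/-- The star product of two polynomials at the value `c` of the formal parameter. -/
def scalarStar (L : Fin (n + 1) → Fin (n + 1) → Poly n) (c : ℂ)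
    (F G : Poly n) : Poly n :=
  ∑ᶠ p : ℕ, c ^ p • starCoeff L p F G

/-- The star product of two formal series of polynomials, which are encoded as the families of
their coefficients. The pair `t = (p, i)` stands for the operator of order `p` applied to the `i`-th
coefficient of the first series. -/
def formalStar (L : Fin (n + 1) → Fin (n + 1) → Poly n)
    (F G : ℤ → Poly n) (m : ℤ) : Poly n :=
  ∑ᶠ t : ℕ × ℤ, starCoeff L t.1 (F t.2) (G (m - t.1 - t.2))

theorem starCoeff_support_finite (c : ℂ) {k : ℕ} {F : Poly n}
    (hF : F.IsHomogeneous k) (G : Poly n) :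
    (support fun p : ℕ => c ^ p • starCoeff L p F G).Finite := by
  refine (Set.finite_Iic k).subset fun p hp => ?_
  by_contra h
  exact hp (by simp only [starCoeff_eq_zero_of_lt hF (not_le.1 h), smul_zero])

section Linearity

variable (c : ℂ) {k : ℕ} {F F' : Poly n} (hF : F.IsHomogeneous k)
include hF

theorem scalarStar_add_left (hF' : F'.IsHomogeneous k) (G : Poly n) :
    scalarStar L c (F + F') G = scalarStar L c F G + scalarStar L c F' G := by
  simp only [scalarStar, map_add, LinearMap.add_apply, smul_add]
  exact finsum_add_distrib (starCoeff_support_finite c hF G) (starCoeff_support_finite c hF' G)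

theorem scalarStar_add_right (G G' : Poly n) :
    scalarStar L c F (G + G') = scalarStar L c F G + scalarStar L c F G' := by
  simp only [scalarStar, map_add, smul_add]
  exact finsum_add_distrib (starCoeff_support_finite c hF G) (starCoeff_support_finite c hF G')

theorem scalarStar_smul_left (a : ℂ) (G : Poly n) :
    scalarStar L c (a • F) G = a • scalarStar L c F G := by
  simp only [scalarStar, smul_finsum' a (starCoeff_support_finite c hF G), map_smul,
    LinearMap.smul_apply, smul_comm a]

theorem scalarStar_smul_right (a : ℂ) (G : Poly n) :
    scalarStar L c F (a • G) = a • scalarStar L c F G := by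
  simp only [scalarStar, smul_finsum' a (starCoeff_support_finite c hF G), map_smul, smul_comm a]

end Linearity

theorem scalarStar_isHomogeneous (hLhom : ∀ a b, (L a b).IsHomogeneous 2) (c : ℂ) {k l : ℕ}
    {F G : Poly n} (hF : F.IsHomogeneous k) (hG : G.IsHomogeneous l) :
    (scalarStar L c F G).IsHomogeneous (k + l) :=
  finsum_isHomogeneous fun p => by
    rw [smul_eq_C_mul]
    exact (starCoeff_isHomogeneous hLhom p hF hG).C_mul _

theorem scalarStar_assoc (hLhom : ∀ a b, (L a b).IsHomogeneous 2) (hskew : ∀ a b, L a b = -L b a)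
    (hT : ∀ a b d, hamDeriv L a b d = 0) (c : ℂ) {k l : ℕ} {F G H : Poly n}
    (hF : F.IsHomogeneous k) (hG : G.IsHomogeneous l) :
    scalarStar L c (scalarStar L c F G) H = scalarStar L c F (scalarStar L c G H) := by
  set φ : ℕ × ℕ → Poly n :=
    fun p => c ^ (p.1 + p.2) • starCoeff L p.2 (starCoeff L p.1 F G) H with hφ
  set ψ : ℕ × ℕ → Poly n :=
    fun p => c ^ (p.1 + p.2) • starCoeff L p.1 F (starCoeff L p.2 G H) with hψ
  have hφf : φ.support.Finite := by
    refine ((Set.finite_Iic k).prod (Set.finite_Iic (k + l))).subset fun p hp => ⟨?_, ?_⟩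
    · by_contra h
      exact hp (by simp [hφ, starCoeff_eq_zero_of_lt hF (not_le.1 h)])
    · by_contra h
      exact hp (by simp [hφ, starCoeff_eq_zero_of_lt (starCoeff_isHomogeneous hLhom p.1 hF hG)
        (not_le.1 h)])
  have hψf : ψ.support.Finite := by
    refine ((Set.finite_Iic k).prod (Set.finite_Iic l)).subset fun p hp => ⟨?_, ?_⟩
    · by_contra h
      exact hp (by simp [hψ, starCoeff_eq_zero_of_lt hF (not_le.1 h)])
    · by_contra h
      exact hp (by simp [hψ, starCoeff_eq_zero_of_lt hG (not_le.1 h)])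
  have h1 : scalarStar L c (scalarStar L c F G) H = ∑ᶠ p, φ p := by
    rw [← finsum_comp_equiv (Equiv.prodComm ℕ ℕ),
      finsum_curry _ (hφf.preimage (Equiv.prodComm ℕ ℕ).injective.injOn)]
    refine finsum_congr fun q => ?_
    have := linearMap_finsum (c ^ q • (starCoeff L q).flip H)
      (starCoeff_support_finite (L := L) c hF G)
    refine this.trans (finsum_congr fun p => ?_)
    simp [hφ, smul_smul, pow_add, mul_comm]
  have h2 : scalarStar L c F (scalarStar L c G H) = ∑ᶠ p, ψ p := by
    rw [finsum_curry _ hψf]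
    refine finsum_congr fun p => ?_
    have := linearMap_finsum (c ^ p • starCoeff L p F) (starCoeff_support_finite (L := L) c hG H)
    refine this.trans (finsum_congr fun q => ?_)
    simp [hψ, smul_smul, pow_add, mul_comm]
  rw [h1, h2]
  refine finsum_eq_finsum_of_antidiagonal hφf hψf fun N => ?_
  have h3 : ∀ χ : ℕ × ℕ → Poly n,
      ∑ p ∈ Finset.HasAntidiagonal.antidiagonal N, c ^ (p.1 + p.2) • χ p
        = c ^ N • ∑ p ∈ Finset.HasAntidiagonal.antidiagonal N, χ p := fun χ => by
    rw [Finset.smul_sum]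
    exact Finset.sum_congr rfl fun p hp => by rw [Finset.HasAntidiagonal.mem_antidiagonal.1 hp]
  rw [h3, h3, sum_starCoeff_assoc hskew hT]

section Formal

variable {κ : FormalKind} {F G H : ℤ → Poly n}

theorem formalStar_support_finite (hF : κ.Admissible F.support) (hG : κ.Admissible G.support)
    {k : ℕ} (hFk : ∀ i, (F i).IsHomogeneous k) (m : ℤ) :
    (support fun t : ℕ × ℤ => starCoeff L t.1 (F t.2) (G (m - t.1 - t.2))).Finite := by
  have h : (⋃ p ∈ Set.Iic k, (fun t : ℤ × ℤ => (p, t.1)) '' {t : ℤ × ℤ | t.1 ∈ F.support ∧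
      t.2 ∈ G.support ∧ m - p - t.1 - t.2 ∈ ({0} : Set ℤ)}).Finite :=
    (Set.finite_Iic k).biUnion fun p _ =>
      (hF.finite_convolution hG κ.admissible_singleton_zero _).image _
  refine h.subset fun t ht => ?_
  have ht' : starCoeff L t.1 (F t.2) (G (m - t.1 - t.2)) ≠ 0 := ht
  have h1 : t.1 ≤ k := by
    by_contra h
    exact ht' (starCoeff_eq_zero_of_lt (hFk _) (not_le.1 h) _)
  refine Set.mem_biUnion (show t.1 ∈ Set.Iic k from h1)
    ⟨(t.2, m - t.1 - t.2), ⟨fun h => ht' ?_, fun h => ht' ?_, by simp⟩, rfl⟩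
  · simp only [h, map_zero, LinearMap.zero_apply]
  · simp only [h, map_zero]

section Linearity

variable {F' G' : ℤ → Poly n} (hF : κ.Admissible F.support)
  (hG : κ.Admissible G.support) {k : ℕ} (hFk : ∀ i, (F i).IsHomogeneous k)
include hF hG hFk

theorem formalStar_add_left (hF' : κ.Admissible F'.support) (hFk' : ∀ i, (F' i).IsHomogeneous k)
    (m : ℤ) : formalStar L (F + F') G m = formalStar L F G m + formalStar L F' G m := by
  simp only [formalStar, Pi.add_apply, map_add, LinearMap.add_apply]
  exact finsum_add_distrib (formalStar_support_finite hF hG hFk m)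
    (formalStar_support_finite hF' hG hFk' m)

theorem formalStar_add_right (hG' : κ.Admissible G'.support) (m : ℤ) :
    formalStar L F (G + G') m = formalStar L F G m + formalStar L F G' m := by
  simp only [formalStar, Pi.add_apply, map_add]
  exact finsum_add_distrib (formalStar_support_finite hF hG hFk m)
    (formalStar_support_finite hF hG' hFk m)

theorem formalStar_smul_left (a : ℂ) (m : ℤ) :
    formalStar L (a • F) G m = a • formalStar L F G m := by
  simp only [formalStar, smul_finsum' a (formalStar_support_finite hF hG hFk m), Pi.smul_apply,
    map_smul, LinearMap.smul_apply]

theorem formalStar_smul_right (a : ℂ) (m : ℤ) :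
    formalStar L F (a • G) m = a • formalStar L F G m := by
  simp only [formalStar, smul_finsum' a (formalStar_support_finite hF hG hFk m), Pi.smul_apply,
    map_smul]

end Linearity

theorem formalStar_isHomogeneous (hLhom : ∀ a b, (L a b).IsHomogeneous 2) {k l : ℕ}
    (hFk : ∀ i, (F i).IsHomogeneous k) (hGl : ∀ i, (G i).IsHomogeneous l) (m : ℤ) :
    (formalStar L F G m).IsHomogeneous (k + l) :=
  finsum_isHomogeneous fun _ => starCoeff_isHomogeneous hLhom _ (hFk _) (hGl _)

theorem formalStar_admissible (hF : κ.Admissible F.support) (hG : κ.Admissible G.support)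
    {k : ℕ} (hFk : ∀ i, (F i).IsHomogeneous k) : κ.Admissible (formalStar L F G).support := by
  refine (hF.shifted_add hG k).mono fun m hm => ?_
  by_contra h
  refine hm (finsum_eq_zero_of_forall_eq_zero fun t => ?_)
  by_contra ht
  refine h ⟨t.1, ?_, t.2, fun h0 => ht ?_, fun h0 => ht ?_⟩
  · by_contra h0
    exact ht (starCoeff_eq_zero_of_lt (hFk _) (not_le.1 h0) _)
  · simp only [h0, map_zero, LinearMap.zero_apply]
  · simp only [h0, map_zero]

theorem finite_support_of_orders {φ : (ℤ × ℤ) × (ℕ × ℕ) → Poly n} {m : ℤ}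
    {K K' : ℕ} (hF : κ.Admissible F.support) (hG : κ.Admissible G.support)
    (hH : κ.Admissible H.support)
    (h : ∀ t, φ t ≠ 0 → (t.2.1 ≤ K ∧ t.2.2 ≤ K') ∧ t.1.1 ∈ F.support ∧ t.1.2 ∈ G.support ∧
      m - t.2.1 - t.2.2 - t.1.1 - t.1.2 ∈ H.support) : φ.support.Finite := by
  have hfin : (⋃ p ∈ Set.Iic K ×ˢ Set.Iic K', (fun t : ℤ × ℤ => (t, p)) '' {t : ℤ × ℤ |
      t.1 ∈ F.support ∧ t.2 ∈ G.support ∧ m - p.1 - p.2 - t.1 - t.2 ∈ H.support}).Finite :=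
    ((Set.finite_Iic K).prod (Set.finite_Iic K')).biUnion fun p _ =>
      (hF.finite_convolution hG hH _).image _
  refine hfin.subset fun t ht => ?_
  exact Set.mem_biUnion (show t.2 ∈ Set.Iic K ×ˢ Set.Iic K' from (h t ht).1) ⟨t.1, (h t ht).2, rfl⟩

/-- Both iterated products are sums over the orders `p, q` of the two operators and the indices `i, j` of
the coefficients of `F` and `G`; for fixed `i, j`, the coefficient of `H` depends on `p + q` only. -/
theorem formalStar_assoc (hLhom : ∀ a b, (L a b).IsHomogeneous 2) (hskew : ∀ a b, L a b = -L b a)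
    (hT : ∀ a b d, hamDeriv L a b d = 0) (hF : κ.Admissible F.support)
    (hG : κ.Admissible G.support) (hH : κ.Admissible H.support) {k l : ℕ}
    (hFk : ∀ i, (F i).IsHomogeneous k) (hGl : ∀ i, (G i).IsHomogeneous l) (m : ℤ) :
    formalStar L (formalStar L F G) H m = formalStar L F (formalStar L G H) m := by
  set φ : (ℤ × ℤ) × (ℕ × ℕ) → Poly n := fun t =>
    starCoeff L t.2.2 (starCoeff L t.2.1 (F t.1.1) (G t.1.2))
      (H (m - t.2.1 - t.2.2 - t.1.1 - t.1.2)) with hφ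
  set ψ : (ℤ × ℤ) × (ℕ × ℕ) → Poly n := fun t =>
    starCoeff L t.2.1 (F t.1.1) (starCoeff L t.2.2 (G t.1.2)
      (H (m - t.2.1 - t.2.2 - t.1.1 - t.1.2))) with hψ
  have hφf : φ.support.Finite := by
    refine finite_support_of_orders (m := m) (K := k) (K' := k + l) hF hG hH fun t ht =>
      ⟨⟨?_, ?_⟩, fun h => ht ?_, fun h => ht ?_, fun h => ht ?_⟩
    · by_contra h
      exact ht (by simp only [hφ, starCoeff_eq_zero_of_lt (hFk _) (not_le.1 h), map_zero,
        LinearMap.zero_apply])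
    · by_contra h
      exact ht (starCoeff_eq_zero_of_lt (starCoeff_isHomogeneous hLhom _ (hFk _) (hGl _))
        (not_le.1 h) _)
    · simp only [hφ, h, map_zero, LinearMap.zero_apply]
    · simp only [hφ, h, map_zero, LinearMap.zero_apply]
    · simp only [hφ, h, map_zero]
  have hψf : ψ.support.Finite := by
    refine finite_support_of_orders (m := m) (K := k) (K' := l) hF hG hH fun t ht =>
      ⟨⟨?_, ?_⟩, fun h => ht ?_, fun h => ht ?_, fun h => ht ?_⟩
    · by_contra h
      exact ht (starCoeff_eq_zero_of_lt (hFk _) (not_le.1 h) _)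
    · by_contra h
      exact ht (by simp only [hψ, starCoeff_eq_zero_of_lt (hGl _) (not_le.1 h), map_zero])
    · simp only [hψ, h, map_zero, LinearMap.zero_apply]
    · simp only [hψ, h, map_zero, LinearMap.zero_apply]
    · simp only [hψ, h, map_zero]
  -- In the product bracketed to the left, the index of the inner product is `p + i + j`.
  let e₁ : (ℕ × ℤ) × (ℕ × ℤ) ≃ (ℤ × ℤ) × (ℕ × ℕ) :=
    { toFun := fun x => ((x.2.2, x.1.2 - x.2.1 - x.2.2), (x.2.1, x.1.1))
      invFun := fun y => ((y.2.2, y.2.1 + y.1.1 + y.1.2), (y.2.1, y.1.1))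
      left_inv := fun x => by ext <;> simp
      right_inv := fun y => by ext <;> simp; ring }
  let e₂ : (ℕ × ℤ) × (ℕ × ℤ) ≃ (ℤ × ℤ) × (ℕ × ℕ) :=
    { toFun := fun x => ((x.1.2, x.2.2), (x.1.1, x.2.1))
      invFun := fun y => ((y.2.1, y.1.1), (y.2.2, y.1.2))
      left_inv := fun _ => rfl
      right_inv := fun _ => rfl }
  have h1 : formalStar L (formalStar L F G) H m = ∑ᶠ t, φ t := by
    rw [← finsum_comp_equiv e₁, finsum_curry _ (hφf.preimage e₁.injective.injOn)]
    refine finsum_congr fun s => ?_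
    have := linearMap_finsum ((starCoeff L s.1).flip (H (m - s.1 - s.2)))
      (formalStar_support_finite (L := L) hF hG hFk s.2)
    refine this.trans (finsum_congr fun t => ?_)
    simp only [hφ, e₁, Equiv.coe_fn_mk, LinearMap.flip_apply]
    congr 2
    ring
  have h2 : formalStar L F (formalStar L G H) m = ∑ᶠ t, ψ t := by
    rw [← finsum_comp_equiv e₂, finsum_curry _ (hψf.preimage e₂.injective.injOn)]
    refine finsum_congr fun s => ?_
    have := linearMap_finsum (starCoeff L s.1 (F s.2))
      (formalStar_support_finite (L := L) hG hH hGl (m - s.1 - s.2))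
    refine this.trans (finsum_congr fun t => ?_)
    simp only [hψ, e₂, Equiv.coe_fn_mk]
    congr 3
    ring
  rw [h1, h2, finsum_curry _ hφf, finsum_curry _ hψf]
  refine finsum_congr fun x => ?_
  have hinj : Function.Injective fun p : ℕ × ℕ => (x, p) := Prod.mk_right_injective x
  refine finsum_eq_finsum_of_antidiagonal (hφf.preimage hinj.injOn) (hψf.preimage hinj.injOn)
    fun N => ?_
  have h3 : ∀ p ∈ Finset.HasAntidiagonal.antidiagonal N,
      H (m - p.1 - p.2 - x.1 - x.2) = H (m - N - x.1 - x.2) := fun p hp => by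
    rw [← Finset.HasAntidiagonal.mem_antidiagonal.1 hp]
    congr 1
    push_cast
    ring
  calc _ = ∑ p ∈ Finset.HasAntidiagonal.antidiagonal N,
        starCoeff L p.2 (starCoeff L p.1 (F x.1) (G x.2)) (H (m - N - x.1 - x.2)) :=
        Finset.sum_congr rfl fun p hp => by simp only [hφ, h3 p hp]
    _ = _ := sum_starCoeff_assoc hskew hT N _ _ _
    _ = _ := Finset.sum_congr rfl fun p hp => by simp only [hψ, h3 p hp]

/-- Substitution of a scalar `c ≠ 0` for the formal parameter is multiplicative. -/
theorem finsum_zpow_smul_formalStar {c : ℂ} (hc : c ≠ 0) (hF : F.support.Finite)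
    (hG : G.support.Finite) {k : ℕ} (hFk : ∀ i, (F i).IsHomogeneous k) :
    ∑ᶠ m : ℤ, c ^ m • formalStar L F G m
      = scalarStar L c (∑ᶠ i : ℤ, c ^ i • F i) (∑ᶠ j : ℤ, c ^ j • G j) := by
  set χ : ℕ × (ℤ × ℤ) → Poly n := fun t =>
    c ^ t.1 • starCoeff L t.1 (c ^ t.2.1 • F t.2.1) (c ^ t.2.2 • G t.2.2) with hχ
  have hχf : χ.support.Finite := by
    refine ((Set.finite_Iic k).prod (hF.prod hG)).subset fun t ht =>
      ⟨?_, fun h => ht ?_, fun h => ht ?_⟩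
    · by_contra h
      exact ht (by simp [hχ, starCoeff_eq_zero_of_lt (hFk _) (not_le.1 h)])
    · simp [hχ, h]
    · simp [hχ, h]
  have hFc : (support fun i : ℤ => c ^ i • F i).Finite :=
    hF.subset fun i hi h => hi (by simp [show F i = 0 from h])
  have hGc : (support fun i : ℤ => c ^ i • G i).Finite :=
    hG.subset fun i hi h => hi (by simp [show G i = 0 from h])
  let e : ℤ × (ℕ × ℤ) ≃ ℕ × (ℤ × ℤ) :=
    { toFun := fun x => (x.2.1, (x.2.2, x.1 - x.2.1 - x.2.2))
      invFun := fun y => (y.1 + y.2.1 + y.2.2, (y.1, y.2.1))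
      left_inv := fun x => by ext <;> simp
      right_inv := fun y => by ext <;> simp; ring }
  have h1 : ∑ᶠ m : ℤ, c ^ m • formalStar L F G m = ∑ᶠ t, χ t := by
    rw [← finsum_comp_equiv e, finsum_curry _ (hχf.preimage e.injective.injOn)]
    refine finsum_congr fun m => ?_
    have := linearMap_finsum (c ^ m • (LinearMap.id : Poly n →ₗ[ℂ] _))
      (formalStar_support_finite (κ := .laurentPolynomial) (L := L) hF hG hFk m)
    refine this.trans (finsum_congr fun t => ?_)
    have hm : c ^ m = c ^ t.1 * (c ^ (m - t.1 - t.2) * c ^ t.2) := by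
      rw [← zpow_add₀ hc, ← zpow_natCast, ← zpow_add₀ hc]
      congr 1
      ring
    simp [hχ, e, smul_smul, hm]
  have h2 : scalarStar L c (∑ᶠ i : ℤ, c ^ i • F i) (∑ᶠ j : ℤ, c ^ j • G j) = ∑ᶠ t, χ t := by
    rw [finsum_curry _ hχf]
    refine finsum_congr fun p => ?_
    have hp : (support fun t : ℤ × ℤ => χ (p, t)).Finite :=
      hχf.preimage (Prod.mk_right_injective p).injOn
    rw [finsum_curry _ hp]
    have := linearMap_finsum (c ^ p • (starCoeff L p).flip (∑ᶠ j : ℤ, c ^ j • G j)) hFc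
    refine this.trans (finsum_congr fun i => ?_)
    exact linearMap_finsum (c ^ p • (starCoeff L p) (c ^ i • F i)) hGc
  rw [h1, h2]

end Formal

end

section

open MvPolynomial
open Function (support)

variable {n : ℕ} {L : Fin (n + 1) → Fin (n + 1) → Poly n}

/-! ### The star products of sections -/

/-- The star product `H⁰(O(k)) × H⁰(O(l)) → H⁰(O(k + l))` at the value `c` of the parameter. -/
def scalarProduct (L : Fin (n + 1) → Fin (n + 1) → Poly n) (c : ℂ)
    (k l : ℕ) : H0 n k →ₗ[ℂ] H0 n l →ₗ[ℂ] H0 n ((k + l : ℕ) : ℤ) :=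
  LinearMap.mk₂ ℂ (fun f g => ofPoly n (k + l) (scalarStar L c (toPoly n k f) (toPoly n l g)))
    (fun f f' g => by
      rw [map_add, scalarStar_add_left c (toPoly_isHomogeneous f) (toPoly_isHomogeneous f'),
        map_add])
    (fun a f g => by rw [map_smul, scalarStar_smul_left c (toPoly_isHomogeneous f), map_smul])
    (fun f g g' => by rw [map_add, scalarStar_add_right c (toPoly_isHomogeneous f), map_add])
    (fun a f g => by rw [map_smul, scalarStar_smul_right c (toPoly_isHomogeneous f), map_smul])

theorem toPoly_scalarProduct (hLhom : ∀ a b, (L a b).IsHomogeneous 2) (c : ℂ) {k l : ℕ}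
    (f : H0 n k) (g : H0 n l) : toPoly n (k + l) (scalarProduct L c k l f g)
      = scalarStar L c (toPoly n k f) (toPoly n l g) :=
  toPoly_ofPoly (scalarStar_isHomogeneous hLhom c (toPoly_isHomogeneous f) (toPoly_isHomogeneous g))

/-- The family of polynomials that are the coefficients of a formal section. -/
def polySeries (κ : FormalKind) (n k : ℕ) (f : formalSections κ n k) (m : ℤ) :
    Poly n :=
  toPoly n k (f.1 m)

theorem polySeries_isHomogeneous {κ : FormalKind} {k : ℕ} (f : formalSections κ n k) (m : ℤ) :
    (polySeries κ n k f m).IsHomogeneous k :=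
  toPoly_isHomogeneous _

theorem polySeries_admissible {κ : FormalKind} {k : ℕ} (f : formalSections κ n k) :
    κ.Admissible (polySeries κ n k f).support :=
  FormalKind.Admissible.mono f.2 fun m hm h => hm (by simp [polySeries, h])

theorem polySeries_injective (κ : FormalKind) (n k : ℕ) : Function.Injective (polySeries κ n k) :=
  fun _ _ h => Subtype.ext <| funext fun m => toPoly_injective n k (congrFun h m)

theorem polySeries_add {κ : FormalKind} {k : ℕ} (f g : formalSections κ n k) :
    polySeries κ n k (f + g) = polySeries κ n k f + polySeries κ n k g := by
  funext m
  exact map_add (toPoly n k) (f.1 m) (g.1 m)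

theorem polySeries_smul {κ : FormalKind} {k : ℕ} (a : ℂ) (f : formalSections κ n k) :
    polySeries κ n k (a • f) = a • polySeries κ n k f := by
  funext m
  exact map_smul (toPoly n k) a (f.1 m)

/-- The star product of formal sections of `O(k)` and of `O(l)`. -/
def formalProduct (L : Fin (n + 1) → Fin (n + 1) → Poly n) (κ : FormalKind)
    (k l : ℕ) :
    formalSections κ n k →ₗ[ℂ] formalSections κ n l →ₗ[ℂ] formalSections κ n (k + l) :=
  LinearMap.mk₂ ℂ
    (fun f g => ⟨fun m => ofPoly n (k + l)
      (formalStar L (polySeries κ n k f) (polySeries κ n l g) m),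
      (formalStar_admissible (L := L) (polySeries_admissible f) (polySeries_admissible g)
        (polySeries_isHomogeneous f)).mono fun m hm h => hm (by
          simp only [show formalStar L _ _ m = 0 from h, map_zero])⟩)
    (fun f f' g => Subtype.ext <| funext fun m => by
      refine (congrArg (ofPoly n (k + l)) ?_).trans (map_add _ _ _)
      rw [polySeries_add]
      exact formalStar_add_left (polySeries_admissible f) (polySeries_admissible g)
        (polySeries_isHomogeneous f) (polySeries_admissible f') (polySeries_isHomogeneous f') m)
    (fun a f g => Subtype.ext <| funext fun m => by
      refine (congrArg (ofPoly n (k + l)) ?_).trans (map_smul _ a _)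
      rw [polySeries_smul]
      exact formalStar_smul_left (polySeries_admissible f) (polySeries_admissible g)
        (polySeries_isHomogeneous f) a m)
    (fun f g g' => Subtype.ext <| funext fun m => by
      refine (congrArg (ofPoly n (k + l)) ?_).trans (map_add _ _ _)
      rw [polySeries_add]
      exact formalStar_add_right (polySeries_admissible f) (polySeries_admissible g)
        (polySeries_isHomogeneous f) (polySeries_admissible g') m)
    (fun a f g => Subtype.ext <| funext fun m => by
      refine (congrArg (ofPoly n (k + l)) ?_).trans (map_smul _ a _)
      rw [polySeries_smul]
      exact formalStar_smul_right (polySeries_admissible f) (polySeries_admissible g)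
        (polySeries_isHomogeneous f) a m)

/-- The star product on `⨁ H⁰(O(k))` at the value `c` of the parameter. -/
abbrev scalarStarProduct (L : Fin (n + 1) → Fin (n + 1) → Poly n) (c : ℂ) :
    SectionSpace n →ₗ[ℂ] SectionSpace n →ₗ[ℂ] SectionSpace n :=
  gradedProduct (V := fun k : ℕ => H0 n k) (scalarProduct L c)

/-- The star product on the direct sum of the spaces of formal sections. -/
abbrev formalStarProduct (L : Fin (n + 1) → Fin (n + 1) → Poly n)
    (κ : FormalKind) :
    FormalSectionSpace κ n →ₗ[ℂ] FormalSectionSpace κ n →ₗ[ℂ] FormalSectionSpace κ n :=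
  gradedProduct (V := fun k : ℕ => formalSections κ n k) (formalProduct L κ)

theorem polySeries_formalProduct (hLhom : ∀ a b, (L a b).IsHomogeneous 2) (κ : FormalKind)
    {k l : ℕ} (f : formalSections κ n k) (g : formalSections κ n l) :
    polySeries κ n (k + l) (formalProduct L κ k l f g)
      = formalStar L (polySeries κ n k f) (polySeries κ n l g) := by
  funext m
  exact toPoly_ofPoly (formalStar_isHomogeneous hLhom (polySeries_isHomogeneous f)
    (polySeries_isHomogeneous g) m)

/-- The formal section `f μ⁰`. -/
def constSeries (κ : FormalKind) {n k : ℕ} (f : H0 n k) : formalSections κ n k :=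
  ⟨Pi.single 0 f, κ.admissible_singleton_zero.mono Pi.support_single_subset⟩

theorem polySeries_constSeries (κ : FormalKind) {k : ℕ} (f : H0 n k) (m : ℤ) :
    polySeries κ n k (constSeries κ f) m = if m = 0 then toPoly n k f else 0 := by
  change toPoly n k ((Pi.single 0 f : ℤ → H0 n k) m) = _
  rw [Pi.single_apply]
  split_ifs <;> simp

theorem scalarStar_one_left (c : ℂ) (F : Poly n) :
    scalarStar L c 1 F = F := by
  rw [scalarStar, finsum_eq_single _ 0 fun p hp => by simp [starCoeff_one_left, hp]]
  simp

theorem scalarStar_one_right (c : ℂ) (F : Poly n) :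
    scalarStar L c F 1 = F := by
  rw [scalarStar, finsum_eq_single _ 0 fun p hp => by simp [starCoeff_one_right, hp]]
  simp

theorem formalStar_one_left (F : ℤ → Poly n) :
    formalStar L (fun m => if m = 0 then 1 else 0) F = F := by
  funext m
  rw [formalStar, finsum_eq_single _ ((0, 0) : ℕ × ℤ)]
  · simp
  · rintro ⟨p, i⟩ h
    by_cases hi : i = 0
    · have hp : p ≠ 0 := fun hp => h (by rw [hp, hi])
      simp [hi, starCoeff_one_left, hp]
    · simp [hi]

theorem formalStar_one_right (F : ℤ → Poly n) :
    formalStar L F (fun m => if m = 0 then 1 else 0) = F := by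
  funext m
  rw [formalStar, finsum_eq_single _ ((0, m) : ℕ × ℤ)]
  · simp
  · rintro ⟨p, i⟩ h
    by_cases hp : p = 0
    · have hi : m - i ≠ 0 := fun hi => h (by rw [hp, sub_eq_zero.1 hi])
      simp [hi, hp]
    · dsimp only
      split_ifs
      · simp [starCoeff_one_right, hp]
      · simp

theorem scalarStar_X_X (c : ℂ) (a b : Fin (n + 1)) :
    scalarStar L c (X a) (X b) = X a * X b + (c / 2) • L a b := by
  have h : (support fun p : ℕ => c ^ p • starCoeff L p (X a) (X b)) ⊆ (Finset.range 2 : Set ℕ) := by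
    intro p hp
    by_contra h
    rw [Finset.mem_coe, Finset.mem_range, not_lt] at h
    exact hp (by simp only [starCoeff_eq_zero_of_lt (isHomogeneous_X ℂ a) (by omega : 1 < p),
      smul_zero])
  rw [scalarStar, finsum_eq_sum_of_support_subset _ h]
  simp [Finset.sum_range_succ, starCoeff_one_X_X, smul_smul, div_eq_mul_inv]

theorem formalStar_X_X (a b : Fin (n + 1)) :
    formalStar L (fun m => if m = 0 then X a else 0) (fun m => if m = 0 then X b else 0) 1
      = (1 / 2 : ℂ) • L a b := by
  rw [formalStar, finsum_eq_single _ ((1, 0) : ℕ × ℤ)]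
  · simp [starCoeff_one_X_X]
  · rintro ⟨p, i⟩ h
    by_cases hi : i = 0
    · have hp : (1 : ℤ) - p - i ≠ 0 := fun hp => h (by
        rw [hi] at hp ⊢
        rw [show p = 1 by omega])
      simp only [hp, if_false, map_zero]
    · simp [hi]

theorem toPoly_X (a : Fin (n + 1)) : toPoly n 1 (ofPoly n 1 (X a)) = X a :=
  toPoly_ofPoly (isHomogeneous_X ℂ a)

theorem toPoly_specializeDegree {k : ℕ} (c : ℂ) (f : formalSections .laurentPolynomial n k) :
    toPoly n k (specializeDegree n k c f)
      = ∑ᶠ m : ℤ, c ^ m • polySeries .laurentPolynomial n k f m := by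
  have h : (support fun m : ℤ => c ^ m • f.1 m).Finite :=
    Set.Finite.subset f.2 fun m hm h => hm (by simp [h])
  refine (linearMap_finsum (toPoly n k) h).trans (finsum_congr fun m => ?_)
  rw [map_smul]
  rfl

theorem specialize_lof {k : ℕ} (c : ℂ) (f : formalSections .laurentPolynomial n k) :
    specialize n c (DirectSum.lof ℂ ℕ (fun k : ℕ => formalSections .laurentPolynomial n k) k f)
      = DirectSum.lof ℂ ℕ (fun k : ℕ => H0 n k) k (specializeDegree n k c f) := by
  simp [specialize]

/-! ### Comparison with the bidifferential operators of the statement -/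

section Comparison

variable {Λ : Coeffs n} (hΛ : IsHolomorphicPoisson Λ)
  (hL : ∀ a b z, z ≠ 0 → Λ a b z = eval z (L a b))
include hΛ hL

theorem symbolPower_formal_finite {κ : FormalKind} {k l : ℕ} (f : formalSections κ n k)
    (g : formalSections κ n l) (m : ℤ) :
    {t : ℕ × ℤ | symbolPower Λ t.1 (f.1 t.2).1 (g.1 (m - t.1 - t.2)).1 ≠ 0}.Finite := by
  refine (formalStar_support_finite (L := L) (polySeries_admissible f) (polySeries_admissible g)
    (polySeries_isHomogeneous f) m).subset fun t ht => ?_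
  exact fun h => ht ((symbolPower_eq_zero_iff hΛ hL _ _ _).2 h)

theorem eval_formalStar {κ : FormalKind} {k l : ℕ} (f : formalSections κ n k)
    (g : formalSections κ n l) (m : ℤ) {z : Coord n} (hz : z ≠ 0) :
    eval z (formalStar L (polySeries κ n k f) (polySeries κ n l g) m)
      = ∑ᶠ t : ℕ × ℤ, (1 / (t.1.factorial : ℂ)) * (1 / 2) ^ t.1 *
          symbolPower Λ t.1 (f.1 t.2).1 (g.1 (m - t.1 - t.2)).1 z := by
  refine ((eval z).toAddMonoidHom.map_finsum (formalStar_support_finite (polySeries_admissible f)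
    (polySeries_admissible g) (polySeries_isHomogeneous f) m)).trans (finsum_congr fun t => ?_)
  simp only [symbolPower_sections hΛ hL, if_neg hz]
  exact smul_eval _ _ _

theorem eval_scalarStar {k l : ℕ} (c : ℂ) (f : H0 n k) (g : H0 n l) {z : Coord n} (hz : z ≠ 0) :
    eval z (scalarStar L c (toPoly n k f) (toPoly n l g))
      = ∑ᶠ p : ℕ, (1 / (p.factorial : ℂ)) * (c / 2) ^ p * symbolPower Λ p f.1 g.1 z := by
  refine ((eval z).toAddMonoidHom.map_finsum (starCoeff_support_finite c
    (toPoly_isHomogeneous f) _)).trans (finsum_congr fun p => ?_)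
  simp only [symbolPower_sections hΛ hL, if_neg hz]
  refine (smul_eval _ _ _).trans ?_
  rw [starCoeff_apply, smul_eval, div_pow, div_pow]
  ring

theorem isStarProduct_formalStarProduct (hLhom : ∀ a b, (L a b).IsHomogeneous 2) (κ : FormalKind) :
    IsStarProduct Λ κ (formalStarProduct L κ) := by
  intro k l f g
  refine ⟨symbolPower_formal_finite hΛ hL f g, formalProduct L κ k l f g,
    gradedProduct_lof_lof _ _, fun m z hz => ?_⟩
  rw [← eval_toPoly _ hz, ← eval_formalStar hΛ hL f g m hz, ← polySeries_formalProduct hLhom]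
  rfl

theorem isScalarStarProduct_scalarStarProduct (hLhom : ∀ a b, (L a b).IsHomogeneous 2) (c : ℂ) :
    IsScalarStarProduct Λ c (scalarStarProduct L c) := by
  intro k l f g
  refine ⟨?_, scalarProduct L c k l f g, gradedProduct_lof_lof _ _, fun z hz => ?_⟩
  · refine (Set.finite_Iic k).subset fun p hp => ?_
    by_contra h
    exact hp ((symbolPower_eq_zero_iff hΛ hL _ _ _).2
      (starCoeff_eq_zero_of_lt (toPoly_isHomogeneous f) (not_le.1 h) _))
  · rw [← eval_toPoly _ hz, ← eval_scalarStar hΛ hL c f g hz, toPoly_scalarProduct hLhom]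

/-- The substitution `μ = c ≠ 0` is multiplicative for every product with the required values on
homogeneous formal sections. -/
theorem specialize_isStarProduct (hLhom : ∀ a b, (L a b).IsHomogeneous 2) {c : ℂ} (hc : c ≠ 0)
    {P : FormalSectionSpace .laurentPolynomial n →ₗ[ℂ] FormalSectionSpace .laurentPolynomial n →ₗ[ℂ]
      FormalSectionSpace .laurentPolynomial n} (hP : IsStarProduct Λ .laurentPolynomial P)
    (F G : FormalSectionSpace .laurentPolynomial n) :
    specialize n c (P F G)
      = scalarStarProduct L c (specialize n c F) (specialize n c G) := by
  have h : P.compr₂ (specialize n c)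
      = (scalarStarProduct L c).compl₁₂ (specialize n c) (specialize n c) := by
    refine bilinear_ext fun k l f g => ?_
    obtain ⟨-, e, he, hez⟩ := hP k l f g
    have hes : polySeries .laurentPolynomial n (k + l) e
        = formalStar L (polySeries .laurentPolynomial n k f)
          (polySeries .laurentPolynomial n l g) :=
      funext fun m => toPoly_eq fun z hz => by rw [hez m z hz, eval_formalStar hΛ hL f g m hz]
    simp only [LinearMap.compr₂_apply, LinearMap.compl₁₂_apply]
    rw [he, specialize_lof, specialize_lof, specialize_lof, gradedProduct_lof_lof]
    congr 1
    apply toPoly_injective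
    rw [toPoly_specializeDegree, toPoly_scalarProduct hLhom, toPoly_specializeDegree,
      toPoly_specializeDegree, hes]
    exact finsum_zpow_smul_formalStar hc (polySeries_admissible f) (polySeries_admissible g)
      (polySeries_isHomogeneous f)
  exact congrArg (fun P => P F G) h

end Comparison

theorem formal_noncommutative (hLhom : ∀ a b, (L a b).IsHomogeneous 2)
    (hskew : ∀ a b, L a b = -L b a) {a b : Fin (n + 1)} (hab : L a b ≠ 0) (κ : FormalKind) :
    ∃ F G, formalStarProduct L κ F G ≠ formalStarProduct L κ G F := by
  refine ⟨DirectSum.lof ℂ ℕ (fun k : ℕ => formalSections κ n k) 1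
      (constSeries κ (ofPoly n 1 (X a))),
    DirectSum.lof ℂ ℕ (fun k : ℕ => formalSections κ n k) 1
      (constSeries κ (ofPoly n 1 (X b))), fun h => hab ?_⟩
  rw [gradedProduct_lof_lof, gradedProduct_lof_lof] at h
  -- The coefficients of `μ` in `Z_a ⋆ Z_b` and in `Z_b ⋆ Z_a` differ by `Λ^{a,b}`.
  have h1 := congrFun (congrArg (polySeries κ n (1 + 1))
    (DirectSum.of_injective (β := fun k : ℕ => formalSections κ n k) _ h)) 1
  rw [polySeries_formalProduct hLhom, polySeries_formalProduct hLhom] at h1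
  have h2 : ∀ c : Fin (n + 1), polySeries κ n 1 (constSeries κ (ofPoly n 1 (X c)))
      = fun m => if m = 0 then X c else 0 := fun c => funext fun m => by
    rw [polySeries_constSeries, toPoly_X]
  rw [h2, h2, formalStar_X_X, formalStar_X_X, hskew b a, smul_neg, self_eq_neg] at h1
  exact (smul_eq_zero.1 h1).resolve_left (by norm_num)

theorem scalar_noncommutative (hLhom : ∀ a b, (L a b).IsHomogeneous 2)
    (hskew : ∀ a b, L a b = -L b a) {a b : Fin (n + 1)} (hab : L a b ≠ 0) {c : ℂ} (hc : c ≠ 0) :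
    ∃ F G, scalarStarProduct L c F G ≠ scalarStarProduct L c G F := by
  refine ⟨DirectSum.lof ℂ ℕ (fun k : ℕ => H0 n k) 1 (ofPoly n 1 (X a)),
    DirectSum.lof ℂ ℕ (fun k : ℕ => H0 n k) 1 (ofPoly n 1 (X b)), fun h => hab ?_⟩
  rw [gradedProduct_lof_lof, gradedProduct_lof_lof] at h
  have h1 := congrArg (toPoly n (1 + 1)) (DirectSum.of_injective (β := fun k : ℕ => H0 n k) _ h)
  rw [toPoly_scalarProduct hLhom, toPoly_scalarProduct hLhom, toPoly_X, toPoly_X, scalarStar_X_X,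
    scalarStar_X_X, mul_comm, add_right_inj, hskew b a, smul_neg, self_eq_neg] at h1
  exact (smul_eq_zero.1 h1).resolve_left (by simp [hc])

theorem formalStarProduct_assoc (hLhom : ∀ a b, (L a b).IsHomogeneous 2)
    (hskew : ∀ a b, L a b = -L b a) (hT : ∀ a b d, hamDeriv L a b d = 0) (κ : FormalKind)
    (F G H : FormalSectionSpace κ n) :
    formalStarProduct L κ (formalStarProduct L κ F G) H
      = formalStarProduct L κ F (formalStarProduct L κ G H) := by
  refine gradedProduct_assoc (polySeries_injective κ n) (fun k l m f g h => ?_) F G H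
  simp only [polySeries_formalProduct hLhom]
  exact funext fun i => formalStar_assoc hLhom hskew hT (polySeries_admissible f)
    (polySeries_admissible g) (polySeries_admissible h) (polySeries_isHomogeneous f)
    (polySeries_isHomogeneous g) i

theorem scalarStarProduct_assoc (hLhom : ∀ a b, (L a b).IsHomogeneous 2)
    (hskew : ∀ a b, L a b = -L b a) (hT : ∀ a b d, hamDeriv L a b d = 0) (c : ℂ)
    (F G H : SectionSpace n) :
    scalarStarProduct L c (scalarStarProduct L c F G) H
      = scalarStarProduct L c F (scalarStarProduct L c G H) := by
  refine gradedProduct_assoc (toPoly_injective n) (fun k l m f g h => ?_) F G H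
  simp only [toPoly_scalarProduct hLhom]
  exact scalarStar_assoc hLhom hskew hT c (toPoly_isHomogeneous f) (toPoly_isHomogeneous g)

theorem formalStarProduct_one (hLhom : ∀ a b, (L a b).IsHomogeneous 2) (κ : FormalKind)
    (F : FormalSectionSpace κ n) :
    formalStarProduct L κ (formalOne κ n) F = F ∧
      formalStarProduct L κ F (formalOne κ n) = F := by
  have h1 : polySeries κ n 0 (constSeries κ (oneSection n)) = fun m => if m = 0 then 1 else 0 :=
    funext fun m => by rw [polySeries_constSeries, toPoly_oneSection]
  refine gradedProduct_one (e := constSeries κ (oneSection n)) (polySeries_injective κ n)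
    (fun k f => ?_) (fun k f => ?_) F
  · rw [polySeries_formalProduct hLhom, h1, formalStar_one_left]
  · rw [polySeries_formalProduct hLhom, h1, formalStar_one_right]

theorem scalarStarProduct_one (hLhom : ∀ a b, (L a b).IsHomogeneous 2) (c : ℂ)
    (F : SectionSpace n) :
    scalarStarProduct L c (one n) F = F ∧
      scalarStarProduct L c F (one n) = F := by
  refine gradedProduct_one (e := oneSection n) (toPoly_injective n)
    (fun k f => ?_) (fun k f => ?_) F
  · rw [toPoly_scalarProduct hLhom, toPoly_oneSection, scalarStar_one_left]
  · rw [toPoly_scalarProduct hLhom, toPoly_oneSection, scalarStar_one_right]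

end

end StarCP

end

theorem theorem1p2 (n : ℕ) (Λ : StarCP.Coeffs n)
    (hΛ : StarCP.IsHolomorphicPoisson Λ) (hrel : StarCP.OrderedRelation Λ) :
    (∀ κ : StarCP.FormalKind,
      ∃ P : StarCP.FormalSectionSpace κ n →ₗ[ℂ] StarCP.FormalSectionSpace κ n →ₗ[ℂ]
          StarCP.FormalSectionSpace κ n,
        StarCP.IsStarProduct Λ κ P ∧
        (∀ F G H, P (P F G) H = P F (P G H)) ∧
        (∀ F, P (StarCP.formalOne κ n) F = F ∧ P F (StarCP.formalOne κ n) = F) ∧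
        (Λ ≠ 0 → ∃ F G, P F G ≠ P G F)) ∧
    (∀ c : ℂ,
      ∃ Q : StarCP.SectionSpace n →ₗ[ℂ] StarCP.SectionSpace n →ₗ[ℂ] StarCP.SectionSpace n,
        StarCP.IsScalarStarProduct Λ c Q ∧
        (∀ F G H, Q (Q F G) H = Q F (Q G H)) ∧
        (∀ F, Q (StarCP.one n) F = F ∧ Q F (StarCP.one n) = F) ∧
        (Λ ≠ 0 → c ≠ 0 → ∃ F G, Q F G ≠ Q G F) ∧
        (c ≠ 0 → ∀ P : StarCP.FormalSectionSpace .laurentPolynomial n →ₗ[ℂ]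
            StarCP.FormalSectionSpace .laurentPolynomial n →ₗ[ℂ]
            StarCP.FormalSectionSpace .laurentPolynomial n,
          StarCP.IsStarProduct Λ .laurentPolynomial P →
          ∀ F G, StarCP.specialize n c (P F G)
            = Q (StarCP.specialize n c F) (StarCP.specialize n c G))) := by
  choose L hLhom hL using fun a b =>
    StarCP.exists_mvPolynomial_of_mem_H0 (k := 2) ⟨Λ a b, hΛ.holomorphic a b⟩
  have hskew : ∀ a b, L a b = -L b a := fun a b => StarCP.eq_of_eval_eq fun z hz => by
    rw [map_neg, ← hL _ _ z hz, ← hL _ _ z hz]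
    exact hΛ.skew a b z
  have hT := StarCP.hamDeriv_eq_zero hLhom hL hΛ hrel
  have hne : Λ ≠ 0 → ∃ a b, L a b ≠ 0 := by
    intro h
    by_contra! h0
    refine h (funext fun a => funext fun b => funext fun z => ?_)
    by_cases hz : z = 0
    · rw [hz]
      exact StarCP.section_zero ⟨Λ a b, hΛ.holomorphic a b⟩
    · exact (hL a b z hz).trans (by rw [h0 a b, map_zero]; rfl)
  refine ⟨fun κ => ⟨StarCP.formalStarProduct L κ,
    StarCP.isStarProduct_formalStarProduct hΛ hL hLhom κ,
    StarCP.formalStarProduct_assoc hLhom hskew hT κ, StarCP.formalStarProduct_one hLhom κ,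
    fun h => ?_⟩, fun c => ⟨StarCP.scalarStarProduct L c,
    StarCP.isScalarStarProduct_scalarStarProduct hΛ hL hLhom c,
    StarCP.scalarStarProduct_assoc hLhom hskew hT c, StarCP.scalarStarProduct_one hLhom c,
    fun h hc => ?_, fun hc P hP => StarCP.specialize_isStarProduct hΛ hL hLhom hc hP⟩⟩
  · obtain ⟨a, b, hab⟩ := hne h
    exact StarCP.formal_noncommutative hLhom hskew hab κ
  · obtain ⟨a, b, hab⟩ := hne h
    exact StarCP.scalar_noncommutative hLhom hskew hab hc
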